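/- **Setting.** Let $T$ be an endofunctor on sets and $\Lambda$ a set of unary modal operators, closed under duals, each $\heartsuit\in\Lambda$ with a representation size $|\heartsuit|\ge 1$ and a monotone predicate lifting $[\![\heartsuit]\!]_X:\mathcal P(X)\to\mathcal P(TX)$, natural in $X$ and compatible with duals. Formulas are $\bot,\top,\psi\wedge\phi,\psi\vee\phi,\heartsuit\phi,X,\mu X.\psi,\nu X.\psi$. The *size* of a formula is its length, where $\eta X.$ is one letter and $\heartsuit$ counts $|\heartsuit|$. The *level* of $\eta X.\psi$ is the least number $m\geq 1$, even for $\eta=\mu$ and odd for $\eta=\nu$, that is at least the level of every fixpoint subformula of $\psi$ in which $X$ is free. The alternation depth $\mathsf{ad}(\chi)$ is the largest level of a fixpoint subformula of $\chi$, or $1$ if there is none. Let $\chi$ be a closed, guarded, clean and irredundant formula (between a fixpoint operator and each use of its variable there is a modality; each variable is bound at most once; each bound variable is used), $n=|\chi|$, $k=\mathsf{ad}(\chi)$, and let $\mathbf F$ be its Fischer–Ladner closure. **One-step satisfiability.** For a finite set $v$ of pairs $\heartsuit a$ with variables $a\in V$, and a set $U\subseteq\mathcal P(V)$, put $[\![v]\!]_1=\bigcap_{\heartsuit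 a\in v}[\![\heartsuit]\!]_U\{u\in U\mid a\in u\}$. The problem is to decide whether $TU\cap[\![v]\!]_1\ne\emptyset$, for finite $U$ and for $v$ in which distinct elements have distinct variables. We are given a procedure for this problem that takes at least one step, and at most $t(m,r)$ steps on inputs with $|v|=\sum_{\heartsuit a\in v}|\heartsuit|\le m$ and $|U|\le r$. **The automaton.** A *selection* is a set of modal literals $\heartsuit\psi\in\mathbf F$. Letters are the selections $\sigma$ and the pairs $(\psi_0\vee\psi_1,0)$, $(\psi_0\vee\psi_1,1)$, $(\psi_0\wedge\psi_1,0)$, $(\eta X.\psi,0)$, $(\top,0)$ with first component in $\mathbf F$. The tracking automaton has states $\mathbf F$ and initial state $\chi$. Under $\sigma$ it moves from $\heartsuit\psi\in\sigma$ to $\psi$, and there is no other move. Under $(\theta,b)$ it stays at each $\psi\neq\theta$; from $\theta=\psi_0\vee\psi_1$ it moves to $\psi_b$, from $\psi_0\wedge\psi_1$ to $\psi_0$ and to $\psi_1$, from $\eta X.\psi$ to its unfolding, and from $\top$ nowhere. Moves that unfold a fixpoint formula have its level as priority, all others priority $1$. The automaton $\mathsf B_\chi$ with initial node $v_0$, transition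 function $\delta$ and priorities $\beta\in\{1,\dots,2nk\}$ on transitions is obtained by turning this parity automaton (acceptance: the highest priority seen infinitely often is even) into the standard Büchi automaton with states $\mathbf F\times(\{0\}\cup\{m\le k\mid m\ge2\text{ even}\})$, determinizing that by the Safra/Piterman construction (compact Safra trees; priorities $0,\dots,2nk-1$), and adding $1$ to all priorities. The label $l(v)\subseteq\mathbf F$ of a node is the set of formulas that occur in the root of its tree. *States* are nodes whose labels contain only modal literals; other nodes are *pre-states*, and for each pre-state $v$ a non-modal formula $\psi_v\in l(v)$ is fixed arbitrarily. **The algorithm.** Let $\delta(v,\psi_v,b)$ be short for $\delta(v,(\psi_v,b))$, and likewise $\beta(v,\psi_v,b)$, where $b$ ranges over those $b\in\{0,1\}$ for which $(\psi_v,b)$ is a letter. For a set $G$ of nodes and sets $\mathbf X=(X_1,\dots,X_{2nk})$ of nodes let $\mathbf X(v)$ be the set of all $l(\delta(v,\sigma))$ such that $\sigma$ is a selection with $\delta(v,\sigma)\in X_{\beta(v,\sigma)}$; let $\overline{\mathbf X}(v)$ be the same with $\notin$ instead of $\in$; and let - $f(\mathbf X)$ be the set of pre-states $v\in G$ with $\delta(v,\psi_v,b)\in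 X_{\beta(v,\psi_v,b)}$ for some $b$, and of states $v\in G$ with $T(\mathbf X(v))\cap[\![l(v)]\!]_1\neq\emptyset$; - $g(\mathbf X)$ be the set of pre-states $v\in G$ with $\delta(v,\psi_v,b)\in X_{\beta(v,\psi_v,b)}$ for all $b$, and of states $v\in G$ with $T(\overline{\mathbf X}(v))\cap[\![l(v)]\!]_1=\emptyset$. Let $\mathbf E_G=\eta_{2nk}X_{2nk}\dots\eta_1X_1.\,f(\mathbf X)$ and $\mathbf A_G=\overline{\eta_{2nk}}X_{2nk}\dots\overline{\eta_1}X_1.\,g(\mathbf X)$, with $\eta_i=\mu$, $\overline{\eta_i}=\nu$ for odd $i$ and $\eta_i=\nu$, $\overline{\eta_i}=\mu$ for even $i$. The *global caching algorithm* starts with $U=\{v_0\}$, $G=\emptyset$ and proceeds as follows. 1. Choose $u\in U$, move it from $U$ to $G$, and add to $U$ all those nodes that are not in $G$ and are of the form $\delta(u,\psi_u,b)$ (if $u$ is a pre-state) or $\delta(u,\sigma)$ for a selection $\sigma$ (if $u$ is a state). 2. Optionally compute $\mathbf E_G$ and return "satisfiable" if it contains $v_0$; optionally compute $\mathbf A_G$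 and return "unsatisfiable" if it contains $v_0$. 3. If $U\ne\emptyset$, go to 1. 4. Compute $\mathbf E_G$; return "satisfiable" if it contains $v_0$, and "unsatisfiable" otherwise. Sets are represented as lists. Each elementary operation (generating a letter or computing a transition of $\mathsf B_\chi$ with its priority, inspecting or restricting a label, comparing two nodes or two labels, inserting an element, a loop round) takes time at most $p(nk)$, where $p$ is a fixed polynomial. A one-step satisfiability check takes the number of steps of the given procedure, which is called on a version of the instance in which distinct modal literals have distinct variables. $\mathbf E_G$ and $\mathbf A_G$ are computed by nested iteration: each of the $2nk$ set variables starts with $\emptyset$ (for $\mu$) or $G$ (for $\nu$) and is updated $|G|$ times. **Lemma.** For every polynomial $p$ there is a constant $C$ such that for all $T$, $\Lambda$, one-step procedures, $t$, $\chi$ and $\psi_v$ as above the following holds, where $n=|\chi|$ and $k=\mathsf{ad}(\chi)$. The iteration computes $\mathbf E_G$ and $\mathbf A_G$ correctly, for every finite set $G$ of nodes. Whatever choices are made in steps 1 and 2, the algorithm terminates with an answer, and its running time is at most $$C\cdot ((nk)!)^{4nk}\cdot t(n,2^n).$$ -/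

import Mathlib

universe u

namespace CoalgMu

/-! ### Coalgebraic logics -/

/-- A coalgebraic logic over the set functor `T` with (unary) modal operators `Λ`: each operator has
a dual, a representation size, and a monotone predicate lifting for `T`, compatible with duals. -/
structure CoalgebraicLogic (T : Type u → Type u) [Functor T] (Λ : Type u) where
  dual : Λ → Λ
  dual_dual : ∀ h, dual (dual h) = h
  /-- size of the representation of a modal operator -/
  size : Λ → ℕ
  size_pos : ∀ h, 0 < size h
  /-- the predicate liftings -/
  sem : Λ → (X : Type u) → Set X → Set (T X)
  natural : ∀ (h : Λ) (X Y : Type u) (f : X → Y) (A : Set Y),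
    sem h X (f ⁻¹' A) = (fun x : T X => f <$> x) ⁻¹' sem h Y A
  sem_dual : ∀ (h : Λ) (X : Type u) (A : Set X), sem h X A = (sem (dual h) X Aᶜ)ᶜ
  mono : ∀ (h : Λ) (X : Type u), Monotone (sem h X)

/-! ### Formulas -/

/-- The two kinds of fixpoint operators. -/
inductive FixKind
  | mu
  | nu

/-- Formulas of the coalgebraic mu-calculus, with natural numbers as fixpoint variables. -/
inductive Formula (Λ : Type u) : Type u
  | bot : Formula Λ
  | top : Formula Λ
  | and : Formula Λ → Formula Λ → Formula Λ
  | or : Formula Λ → Formula Λ → Formula Λ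
  | modal : Λ → Formula Λ → Formula Λ
  | var : ℕ → Formula Λ
  | fix : FixKind → ℕ → Formula Λ → Formula Λ

namespace Formula

variable {Λ : Type u}

/-- The length of a formula; `fix η X` is one letter, a modal operator counts with its
representation size. -/
def size (msize : Λ → ℕ) : Formula Λ → ℕ
  | bot => 1
  | top => 1
  | and φ ψ => 1 + φ.size msize + ψ.size msize
  | or φ ψ => 1 + φ.size msize + ψ.size msize
  | modal h φ => msize h + φ.size msize
  | var _ => 1
  | fix _ _ φ => 1 + φ.size msize

/-- Free fixpoint variables. -/
def fv : Formula Λ → Finset ℕ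
  | bot => ∅
  | top => ∅
  | and φ ψ => φ.fv ∪ ψ.fv
  | or φ ψ => φ.fv ∪ ψ.fv
  | modal _ φ => φ.fv
  | var X => {X}
  | fix _ X φ => φ.fv.erase X

/-- The list of variables bound in a formula, one entry for each fixpoint operator. -/
def bound : Formula Λ → List ℕ
  | bot => []
  | top => []
  | and φ ψ => φ.bound ++ ψ.bound
  | or φ ψ => φ.bound ++ ψ.bound
  | modal _ φ => φ.bound
  | var _ => []
  | fix _ X φ => X :: φ.bound

/-- `X` has a free occurrence that is not in the scope of a modal operator. -/
def UnguardedIn (X : ℕ) : Formula Λ → Prop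
  | bot => False
  | top => False
  | and φ ψ => φ.UnguardedIn X ∨ ψ.UnguardedIn X
  | or φ ψ => φ.UnguardedIn X ∨ ψ.UnguardedIn X
  | modal _ _ => False
  | var Y => Y = X
  | fix _ Y φ => Y ≠ X ∧ φ.UnguardedIn X

/-- Between each fixpoint operator and each use of its variable there is a modal operator. -/
def Guarded : Formula Λ → Prop
  | bot => True
  | top => True
  | and φ ψ => φ.Guarded ∧ ψ.Guarded
  | or φ ψ => φ.Guarded ∧ ψ.Guarded
  | modal _ φ => φ.Guarded
  | var _ => True
  | fix _ X φ => ¬ φ.UnguardedIn X ∧ φ.Guarded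

/-- Each bound variable is used at least once. -/
def Irredundant : Formula Λ → Prop
  | bot => True
  | top => True
  | and φ ψ => φ.Irredundant ∧ ψ.Irredundant
  | or φ ψ => φ.Irredundant ∧ ψ.Irredundant
  | modal _ φ => φ.Irredundant
  | var _ => True
  | fix _ X φ => X ∈ φ.fv ∧ φ.Irredundant

/-- No free variables. -/
def Closed (φ : Formula Λ) : Prop := φ.fv = ∅

/-- Each variable is bound by at most one fixpoint operator. -/
def Clean (φ : Formula Λ) : Prop := φ.bound.Nodup

/-- `φ.subst X θ`: substitution of `θ` for the free occurrences of `X` in `φ` (it is only used with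
closed `θ`). -/
def subst : Formula Λ → ℕ → Formula Λ → Formula Λ
  | bot, _, _ => bot
  | top, _, _ => top
  | and φ ψ, X, θ => and (φ.subst X θ) (ψ.subst X θ)
  | or φ ψ, X, θ => or (φ.subst X θ) (ψ.subst X θ)
  | modal h φ, X, θ => modal h (φ.subst X θ)
  | var Y, X, θ => if Y = X then θ else var Y
  | fix η Y φ, X, θ => if Y = X then fix η Y φ else fix η Y (φ.subst X θ)

/-- `♥ψ` for some modal operator `♥`. -/
def IsModal : Formula Λ → Prop
  | modal _ _ => True
  | _ => False

/-- The least number `≥ m` that is a legal level for a fixpoint of the given kind: least fixpoints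
get even numbers `≥ 2`, greatest fixpoints get odd numbers `≥ 1`. -/
def FixKind.roundUp : FixKind → ℕ → ℕ
  | .mu, m => max 2 (m + m % 2)
  | .nu, m => m + (m + 1) % 2

/-- The largest level of a fixpoint subformula in which `X` is free (`0` if there is none); the
level of `η Y. φ` is the least number of the right parity that is at least as large as the levels
of all fixpoint subformulas of `φ` that depend on `Y`. -/
def depLevel : Formula Λ → ℕ → ℕ
  | bot, _ => 0
  | top, _ => 0
  | and φ ψ, X => max (φ.depLevel X) (ψ.depLevel X)
  | or φ ψ, X => max (φ.depLevel X) (ψ.depLevel X)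
  | modal _ φ, X => φ.depLevel X
  | var _, _ => 0
  | fix η Y φ, X =>
      if X ∈ (fix η Y φ).fv then max (FixKind.roundUp η (φ.depLevel Y)) (φ.depLevel X) else 0

/-- The alternation level of a fixpoint formula (`0` for other formulas). -/
def level : Formula Λ → ℕ
  | fix η Y φ => FixKind.roundUp η (φ.depLevel Y)
  | _ => 0

/-- The largest level of a fixpoint subformula. -/
def maxLevel : Formula Λ → ℕ
  | bot => 0
  | top => 0
  | and φ ψ => max φ.maxLevel ψ.maxLevel
  | or φ ψ => max φ.maxLevel ψ.maxLevel
  | modal _ φ => φ.maxLevel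
  | var _ => 0
  | fix η Y φ => max (fix η Y φ).level φ.maxLevel

/-- The alternation depth: the largest level of a fixpoint subformula, and `1` if there is no
fixpoint operator (`1` is the priority of all steps that do not unfold a fixpoint). -/
def ad (φ : Formula Λ) : ℕ := max 1 φ.maxLevel

/-- One step of the Fischer-Ladner closure. -/
inductive FLStep : Formula Λ → Formula Λ → Prop
  | and_left (φ ψ) : FLStep (and φ ψ) φ
  | and_right (φ ψ) : FLStep (and φ ψ) ψ
  | or_left (φ ψ) : FLStep (or φ ψ) φ
  | or_right (φ ψ) : FLStep (or φ ψ) ψ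
  | modal (h φ) : FLStep (modal h φ) φ
  | unfold (η X φ) : FLStep (fix η X φ) (φ.subst X (fix η X φ))

/-- The Fischer-Ladner closure as a set. -/
def closure (χ : Formula Λ) : Set (Formula Λ) := {ψ | Relation.ReflTransGen FLStep χ ψ}

/-! The Fischer-Ladner closure of a closed formula is finite. -/

/-- Simultaneous substitution. -/
def inst (σ : ℕ → Option (Formula Λ)) : Formula Λ → Formula Λ
  | bot => bot
  | top => top
  | and φ ψ => and (φ.inst σ) (ψ.inst σ)
  | or φ ψ => or (φ.inst σ) (ψ.inst σ)
  | modal h φ => modal h (φ.inst σ)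
  | var Y => (σ Y).getD (var Y)
  | fix η Y φ => fix η Y (φ.inst (Function.update σ Y none))

/-- The formulas that arise from the subformulas of `φ` under `σ`, unfolding each fixpoint once. -/
def expansions : Formula Λ → (ℕ → Option (Formula Λ)) → List (Formula Λ)
  | bot, _ => [bot]
  | top, _ => [top]
  | and φ ψ, σ => (and φ ψ).inst σ :: (φ.expansions σ ++ ψ.expansions σ)
  | or φ ψ, σ => (or φ ψ).inst σ :: (φ.expansions σ ++ ψ.expansions σ)
  | modal h φ, σ => (modal h φ).inst σ :: φ.expansions σ
  | var Y, σ => [(var Y).inst σ]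
  | fix η Y φ, σ =>
      (fix η Y φ).inst σ :: φ.expansions (Function.update σ Y (some ((fix η Y φ).inst σ)))

theorem subst_of_notMem {X : ℕ} {θ : Formula Λ} (φ : Formula Λ) (h : X ∉ φ.fv) :
    φ.subst X θ = φ := by
  induction φ with
  | bot => rfl
  | top => rfl
  | and φ ψ ih1 ih2 => simp [fv] at h; simp [subst, ih1 h.1, ih2 h.2]
  | or φ ψ ih1 ih2 => simp [fv] at h; simp [subst, ih1 h.1, ih2 h.2]
  | modal a φ ih => simp [fv] at h; simp [subst, ih h]
  | var Y => simp [fv] at h; simp [subst, Ne.symm h]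
  | fix η Y φ ih =>
    by_cases hY : Y = X
    · simp [subst, hY]
    · simp only [fv, Finset.mem_erase, not_and] at h
      simp [subst, hY, ih (h (Ne.symm hY))]

theorem inst_none (φ : Formula Λ) : φ.inst (fun _ => none) = φ := by
  induction φ with
  | fix η Y φ ih =>
    have : Function.update (fun _ : ℕ => (none : Option (Formula Λ))) Y none = fun _ => none := by
      ext; simp
    simp only [inst, this, ih]
  | _ => simp_all [inst]

theorem subst_inst {X : ℕ} {θ : Formula Λ} (φ : Formula Λ) (σ : ℕ → Option (Formula Λ))
    (hX : σ X = none) (hσ : ∀ Y c, σ Y = some c → c.Closed) :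
    (φ.inst σ).subst X θ = φ.inst (Function.update σ X (some θ)) := by
  induction φ generalizing σ with
  | bot => rfl
  | top => rfl
  | and φ ψ ih1 ih2 => simp [inst, subst, ih1 σ hX hσ, ih2 σ hX hσ]
  | or φ ψ ih1 ih2 => simp [inst, subst, ih1 σ hX hσ, ih2 σ hX hσ]
  | modal a φ ih => simp [inst, subst, ih σ hX hσ]
  | var Y =>
    by_cases hY : Y = X
    · subst hY; simp [inst, hX, subst]
    · cases hc : σ Y with
      | none => simp [inst, hc, subst, hY]
      | some c =>
        have : X ∉ c.fv := by rw [hσ Y c hc]; simp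
        simp [inst, hc, hY, subst_of_notMem c this]
  | fix η Y φ ih =>
    by_cases hY : Y = X
    · subst hY; simp [inst, subst]
    · have h1 := ih (Function.update σ Y none)
        (by rw [Function.update_of_ne (Ne.symm hY)]; exact hX)
        (by
          intro Z c hc
          by_cases hZ : Z = Y
          · subst hZ; simp at hc
          · rw [Function.update_of_ne hZ] at hc; exact hσ Z c hc)
      simp only [inst, subst, if_neg hY, h1, Function.update_comm hY]

theorem fv_inst (φ : Formula Λ) (σ : ℕ → Option (Formula Λ))
    (hσ : ∀ Y c, σ Y = some c → c.Closed) :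
    ∀ X ∈ (φ.inst σ).fv, X ∈ φ.fv ∧ σ X = none := by
  induction φ generalizing σ with
  | bot => simp [inst, fv]
  | top => simp [inst, fv]
  | and φ ψ ih1 ih2 =>
    intro X hX
    simp only [inst, fv, Finset.mem_union] at hX ⊢
    rcases hX with hX | hX
    · exact ⟨Or.inl (ih1 σ hσ X hX).1, (ih1 σ hσ X hX).2⟩
    · exact ⟨Or.inr (ih2 σ hσ X hX).1, (ih2 σ hσ X hX).2⟩
  | or φ ψ ih1 ih2 =>
    intro X hX
    simp only [inst, fv, Finset.mem_union] at hX ⊢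
    rcases hX with hX | hX
    · exact ⟨Or.inl (ih1 σ hσ X hX).1, (ih1 σ hσ X hX).2⟩
    · exact ⟨Or.inr (ih2 σ hσ X hX).1, (ih2 σ hσ X hX).2⟩
  | modal a φ ih => exact ih σ hσ
  | var Y =>
    intro X hX
    cases hc : σ Y with
    | none =>
      simp only [inst, hc, Option.getD_none, fv, Finset.mem_singleton] at hX ⊢
      subst hX; exact ⟨rfl, hc⟩
    | some c =>
      simp only [inst, hc, Option.getD_some, show c.fv = ∅ from hσ Y c hc] at hX
      simp at hX
  | fix η Y φ ih =>
    intro X hX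
    simp only [inst, fv, Finset.mem_erase] at hX ⊢
    obtain ⟨h1, h2⟩ := ih (Function.update σ Y none) (by
      intro Z c hc
      by_cases hZ : Z = Y
      · subst hZ; simp at hc
      · rw [Function.update_of_ne hZ] at hc; exact hσ Z c hc) X hX.2
    rw [Function.update_of_ne hX.1] at h2
    exact ⟨⟨hX.1, h1⟩, h2⟩

theorem inst_mem_expansions (φ : Formula Λ) (σ : ℕ → Option (Formula Λ)) :
    φ.inst σ ∈ φ.expansions σ := by
  cases φ <;> simp [expansions, inst]

theorem expansions_good (S : Set (Formula Λ)) (φ : Formula Λ) (σ : ℕ → Option (Formula Λ))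
    (hσ : ∀ Y c, σ Y = some c → c.Closed ∧ ∀ θ, FLStep c θ → θ ∈ S)
    (hS : ∀ θ ∈ φ.expansions σ, θ ∈ S) (hfv : ∀ X ∈ φ.fv, σ X ≠ none) :
    ∀ θ ∈ φ.expansions σ, ∀ θ', FLStep θ θ' → θ' ∈ S := by
  induction φ generalizing σ with
  | bot => simp only [expansions, List.mem_singleton]; rintro θ rfl θ' h; cases h
  | top => simp only [expansions, List.mem_singleton]; rintro θ rfl θ' h; cases h
  | and φ ψ ih1 ih2 =>
    simp only [expansions, List.mem_cons, List.mem_append, fv, Finset.mem_union] at hS hfv ⊢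
    rintro θ (rfl | hθ | hθ) θ' h
    · cases h
      · exact hS _ (Or.inr (Or.inl (inst_mem_expansions φ σ)))
      · exact hS _ (Or.inr (Or.inr (inst_mem_expansions ψ σ)))
    · exact ih1 σ hσ (fun x hx => hS x (Or.inr (Or.inl hx))) (fun x hx => hfv x (Or.inl hx)) θ hθ _ h
    · exact ih2 σ hσ (fun x hx => hS x (Or.inr (Or.inr hx))) (fun x hx => hfv x (Or.inr hx)) θ hθ _ h
  | or φ ψ ih1 ih2 =>
    simp only [expansions, List.mem_cons, List.mem_append, fv, Finset.mem_union] at hS hfv ⊢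
    rintro θ (rfl | hθ | hθ) θ' h
    · cases h
      · exact hS _ (Or.inr (Or.inl (inst_mem_expansions φ σ)))
      · exact hS _ (Or.inr (Or.inr (inst_mem_expansions ψ σ)))
    · exact ih1 σ hσ (fun x hx => hS x (Or.inr (Or.inl hx))) (fun x hx => hfv x (Or.inl hx)) θ hθ _ h
    · exact ih2 σ hσ (fun x hx => hS x (Or.inr (Or.inr hx))) (fun x hx => hfv x (Or.inr hx)) θ hθ _ h
  | modal a φ ih =>
    simp only [expansions, List.mem_cons, fv] at hS hfv ⊢
    rintro θ (rfl | hθ) θ' h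
    · cases h
      exact hS _ (Or.inr (inst_mem_expansions φ σ))
    · exact ih σ hσ (fun x hx => hS x (Or.inr hx)) hfv θ hθ _ h
  | var Y =>
    simp only [expansions, List.mem_singleton]
    rintro θ rfl θ' h
    cases hc : σ Y with
    | none => exact absurd hc (hfv Y (by simp [fv]))
    | some c =>
      simp only [inst, hc, Option.getD_some] at h
      exact (hσ Y c hc).2 θ' h
  | fix η Y φ ih =>
    have hσc : ∀ Z c, Function.update σ Y none Z = some c → c.Closed := by
      intro Z c hc
      by_cases hZ : Z = Y
      · subst hZ; simp at hc
      · rw [Function.update_of_ne hZ] at hc; exact (hσ Z c hc).1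
    have hcl : ((fix η Y φ).inst σ).Closed := by
      refine Finset.eq_empty_of_forall_notMem fun X hX => ?_
      have h := fv_inst (fix η Y φ) σ (fun Z c hc => (hσ Z c hc).1) X hX
      exact hfv X h.1 h.2
    have hstep : ∀ θ, FLStep ((fix η Y φ).inst σ) θ → θ ∈ S := by
      intro θ h
      have e : (φ.inst (Function.update σ Y none)).subst Y ((fix η Y φ).inst σ)
          = φ.inst (Function.update σ Y (some ((fix η Y φ).inst σ))) := by
        rw [subst_inst φ _ (by simp) hσc, Function.update_idem]
      have e2 : θ = (φ.inst (Function.update σ Y none)).subst Y ((fix η Y φ).inst σ) := by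
        cases h; rfl
      rw [e2, e]
      refine hS _ ?_
      simp only [expansions, List.mem_cons]
      exact Or.inr (inst_mem_expansions φ _)
    intro θ hθ θ' h
    simp only [expansions, List.mem_cons] at hθ
    rcases hθ with rfl | hθ
    · exact hstep _ h
    · refine ih _ ?_ ?_ ?_ θ hθ θ' h
      · intro Z c hc
        by_cases hZ : Z = Y
        · subst hZ
          simp only [Function.update_self, Option.some.injEq] at hc
          subst hc
          exact ⟨hcl, hstep⟩
        · rw [Function.update_of_ne hZ] at hc; exact hσ Z c hc
      · intro x hx
        refine hS x ?_
        simp only [expansions, List.mem_cons]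
        exact Or.inr hx
      · intro X hX
        by_cases hZ : X = Y
        · subst hZ; simp
        · rw [Function.update_of_ne hZ]
          exact hfv X (by simp [fv, hZ, hX])

theorem closure_finite (χ : Formula Λ) (h : χ.Closed) : χ.closure.Finite := by
  refine Set.Finite.subset (List.finite_toSet (χ.expansions fun _ => none)) ?_
  intro ψ hψ
  have key := expansions_good {θ | θ ∈ χ.expansions fun _ => none} χ (fun _ => none)
    (by simp) (fun θ hθ => hθ) (by rw [show χ.fv = ∅ from h]; simp)
  induction hψ with
  | refl =>
    have h0 := inst_mem_expansions χ (fun _ => none)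
    rwa [inst_none] at h0
  | tail _ hs ih => exact key _ ih _ hs

end Formula

/-- Target formulas: closed, guarded, clean and irredundant. -/
structure Target (Λ : Type u) where
  formula : Formula Λ
  closed : formula.Closed
  guarded : formula.Guarded
  clean : formula.Clean
  irredundant : formula.Irredundant

/-- The Fischer-Ladner closure `F` of the target formula. -/
noncomputable def Target.FL {Λ : Type u} (χ : Target Λ) : Finset (Formula Λ) :=
  (χ.formula.closure_finite χ.closed).toFinset

/-! ### The one-step satisfiability problem -/

section OneStep

variable {T : Type u → Type u} [Functor T] {Λ : Type u}

/-- `T U ∩ ⟦v⟧₁ ≠ ∅`, for a set `v` of modal literals `(♥, a)` over `V` and `U ⊆ 𝒫(V)`. -/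
def CoalgebraicLogic.OneStepSat (L : CoalgebraicLogic T Λ) {V : Type u}
    (v : Finset (Λ × V)) (U : Set (Finset V)) : Prop :=
  ∃ τ : T U, ∀ x ∈ v, τ ∈ L.sem x.1 U {a | x.2 ∈ a.1}

/-- The inputs of the one-step satisfiability problem: `a ≠ b` for distinct `♥₁a, ♥₂b ∈ v`. -/
def IsOneStepInput {V : Type u} (v : Finset (Λ × V)) : Prop :=
  Set.InjOn Prod.snd (v : Set (Λ × V))

/-- `|v|`, the sum of the sizes of the modal operators in `v`. -/
def CoalgebraicLogic.inputSize (L : CoalgebraicLogic T Λ) {V : Type u} (v : Finset (Λ × V)) : ℕ :=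
  ∑ x ∈ v, L.size x.1

/-- A procedure for the one-step satisfiability problem with variables from `V`, together with the
number of steps it takes on each input. -/
structure OneStepSolver (L : CoalgebraicLogic T Λ) (V : Type u) where
  answer : Finset (Λ × V) → Finset (Finset V) → Bool
  steps : Finset (Λ × V) → Finset (Finset V) → ℕ
  steps_pos : ∀ v U, 0 < steps v U
  correct : ∀ v U, IsOneStepInput v → (answer v U = true ↔ L.OneStepSat v (U : Set (Finset V)))

/-- On inputs with `|v| ≤ m` and `|U| ≤ r` the procedure takes at most `t m r` steps. -/
def OneStepSolver.RunsIn {L : CoalgebraicLogic T Λ} {V : Type u} (S : OneStepSolver L V)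
    (t : ℕ → ℕ → ℕ) : Prop :=
  ∀ (v : Finset (Λ × V)) (U : Finset (Finset V)), IsOneStepInput v →
    ∀ m r : ℕ, L.inputSize v ≤ m → U.card ≤ r → S.steps v U ≤ t m r

end OneStep

/-! ### Automata -/

/-- Nondeterministic parity automata with priorities on transitions (the highest priority passed
infinitely often has to be even). -/
structure ParityAutomaton (Q : Type u) (A : Type u) where
  init : Q
  trans : Q → A → Q → Prop
  prio : Q → A → Q → ℕ

/-- Nondeterministic Büchi automata with accepting transitions. -/
structure BuchiAutomaton (Q : Type u) (A : Type u) where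
  init : Q
  trans : Q → A → Q → Prop
  acc : Q → A → Q → Prop

/-- The standard Büchi automaton for a parity automaton with priorities at most `k`: in mode `0` it
simulates the automaton; at any time it may guess an even number `m` with `2 ≤ m ≤ k` and switch to
mode `m`, in which only priorities `≤ m` are allowed and transitions with priority `m` accept. -/
def ParityAutomaton.toBuchi {Q A : Type u} (P : ParityAutomaton Q A) (k : ℕ) :
    BuchiAutomaton (Q × ℕ) A where
  init := (P.init, 0)
  trans q a q' := P.trans q.1 a q'.1 ∧
    ((q.2 = 0 ∧ (q'.2 = 0 ∨ (Even q'.2 ∧ 2 ≤ q'.2 ∧ q'.2 ≤ k))) ∨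
      (q.2 ≠ 0 ∧ q'.2 = q.2 ∧ P.prio q.1 a q'.1 ≤ q.2))
  acc q a q' := q.2 ≠ 0 ∧ q'.2 = q.2 ∧ P.prio q.1 a q'.1 = q.2

/-- Compact Safra trees over the state set `Q`. The non-root nodes of the tree are named by positive
numbers `1, 2, …` in the order of their introduction; `t q` is `none` if `q` is not in the label of
the root, and otherwise it is the list of the non-root nodes that have `q` in their label, from the
child of the root downwards (the labels of siblings are disjoint). -/
abbrev SafraTree (Q : Type u) : Type u := Q → Option (List ℕ)

namespace SafraTree

open scoped Classical

variable {Q A : Type u}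

/-- The names of the non-root nodes. -/
def names (t : SafraTree Q) : Set ℕ := {j | ∃ q π, t q = some π ∧ j ∈ π}

/-- The positions in which `q'` occurs after one powerset step for the letter `a`, where
successors under accepting transitions are put into a new youngest child (with a name larger than
`N`, the largest possible old name) of their node. -/
noncomputable def candidates (B : BuchiAutomaton Q A) (N : ℕ) (t : SafraTree Q) (a : A) (q' : Q) :
    Set (List ℕ) :=
  {ρ | ∃ q π, t q = some π ∧ B.trans q a q' ∧
    ρ = if B.acc q a q' then π ++ [N + 1 + π.getLastD 0] else π}

/-- `π` is preferred to `ρ`: at the first difference it enters an older sibling, or it extends `ρ`. -/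
def Preferred : List ℕ → List ℕ → Prop
  | [], _ => False
  | _ :: _, [] => True
  | i :: π, j :: ρ => i < j ∨ (i = j ∧ Preferred π ρ)

/-- Powerset step with horizontal merge: each state is kept in the oldest sibling only. -/
noncomputable def merged (B : BuchiAutomaton Q A) (N : ℕ) (t : SafraTree Q) (a : A) : SafraTree Q :=
  fun q' =>
    if h : ∃ ρ ∈ candidates B N t a q', ∀ ρ' ∈ candidates B N t a q', ρ' = ρ ∨ Preferred ρ ρ'
    then some h.choose else none

/-- The nodes whose label is the union of the labels of their children. -/
def green (t : SafraTree Q) : Set ℕ :=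
  {j | j ∈ t.names ∧ ∀ q π, t q = some π → π.getLast? ≠ some j}

/-- Cut a list after its first element from `g`. -/
noncomputable def cut (g : Set ℕ) : List ℕ → List ℕ
  | [] => []
  | j :: π => if j ∈ g then [j] else j :: cut g π

/-- Vertical merge: all descendants of green nodes are removed. -/
noncomputable def pruned (t : SafraTree Q) : SafraTree Q :=
  fun q => (t q).map (cut t.green)

/-- Rename the remaining nodes to `1, 2, …`, preserving their order. -/
noncomputable def renamed (t : SafraTree Q) : SafraTree Q :=
  fun q => (t q).map (List.map fun j => Set.ncard {i ∈ t.names | i ≤ j})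

/-- The transition function of the determinized automaton. -/
noncomputable def step (B : BuchiAutomaton Q A) (N : ℕ) (t : SafraTree Q) (a : A) : SafraTree Q :=
  (merged B N t a).pruned.renamed

/-- The priority of a transition of the determinized automaton, between `0` and `2 N - 1`: even if
the oldest node that is green or removed is green, and odd if it is removed (or if there is none);
older nodes have higher priorities. The root has no priority of its own: for automata obtained by
`toBuchi`, mode `0` is never left for good, so that the label of the root is always larger than the
union of the labels of its children. -/
noncomputable def prio (B : BuchiAutomaton Q A) (N : ℕ) (t : SafraTree Q) (a : A) : ℕ :=
  let g : Set ℕ := (merged B N t a).green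
  let r : Set ℕ := t.names \ (merged B N t a).pruned.names
  if r.Nonempty ∧ ∀ j ∈ g, sInf r ≤ j then 2 * N + 1 - 2 * sInf r
  else if g.Nonempty then 2 * N - 2 * sInf g
  else 1

/-- The initial tree: the initial state is in the root. -/
noncomputable def initial (B : BuchiAutomaton Q A) : SafraTree Q :=
  fun q => if q = B.init then some [] else none

end SafraTree

/-! ### The tracking automaton -/

/-- Letters of the tracking automaton: `prop ψ b` stands for `(ψ, b)`, and `sel σ` for a selection. -/
inductive Letter (Λ : Type u) : Type u
  | prop : Formula Λ → Bool → Letter Λ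
  | sel : Finset (Formula Λ) → Letter Λ

/-- The letters `(ψ, b)` of the alphabet for a non-modal formula `ψ`: two letters for disjunctions,
one letter for conjunctions, fixpoint formulas and `⊤`, no letter for `⊥`. -/
def propLetters {Λ : Type u} : Formula Λ → List (Letter Λ)
  | .or φ ψ => [.prop (.or φ ψ) false, .prop (.or φ ψ) true]
  | .and φ ψ => [.prop (.and φ ψ) false]
  | .fix η X φ => [.prop (.fix η X φ) false]
  | .top => [.prop .top false]
  | _ => []

/-- `Tracks ψ a ψ'` if `ψ' ∈ Δ(ψ, a)`. -/
inductive Tracks {Λ : Type u} : Formula Λ → Letter Λ → Formula Λ → Prop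
  | sel (h : Λ) (ψ : Formula Λ) (σ : Finset (Formula Λ)) (mem : Formula.modal h ψ ∈ σ) :
      Tracks (.modal h ψ) (.sel σ) ψ
  | other (ψ θ : Formula Λ) (b : Bool) (ne : ψ ≠ θ) : Tracks ψ (.prop θ b) ψ
  | or_left (φ ψ : Formula Λ) : Tracks (.or φ ψ) (.prop (.or φ ψ) false) φ
  | or_right (φ ψ : Formula Λ) : Tracks (.or φ ψ) (.prop (.or φ ψ) true) ψ
  | and_left (φ ψ : Formula Λ) : Tracks (.and φ ψ) (.prop (.and φ ψ) false) φ
  | and_right (φ ψ : Formula Λ) : Tracks (.and φ ψ) (.prop (.and φ ψ) false) ψ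
  | unfold (η : FixKind) (X : ℕ) (φ : Formula Λ) :
      Tracks (.fix η X φ) (.prop (.fix η X φ) false) (φ.subst X (.fix η X φ))

section Tracking

open scoped Classical

/-- The tracking automaton of a target formula `χ` (its states are the formulas in `χ.FL`, which are
the ones reachable from `χ`). -/
noncomputable def Target.tracking {Λ : Type u} (χ : Target Λ) :
    ParityAutomaton (Formula Λ) (Letter Λ) where
  init := χ.formula
  trans := Tracks
  prio ψ _ ψ' := if ψ = ψ' then 1 else max 1 ψ.level

end Tracking

/-! ### Programs with time -/

/-- A value together with the time taken to compute it. -/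
structure Timed (α : Type u) where
  val : α
  time : ℕ

namespace Timed

universe v

open scoped Classical

variable {α : Type u} {β : Type v}

/-- Return a value, free of charge. -/
protected def pure (a : α) : Timed α := ⟨a, 0⟩

/-- Sequential composition; times add up. -/
protected def bind (x : Timed α) (f : α → Timed β) : Timed β :=
  ⟨(f x.val).val, x.time + (f x.val).time⟩

/-- Charge `c` time units. -/
def charge (c : ℕ) (x : Timed α) : Timed α := ⟨x.val, c + x.time⟩

/-- Does some element of the list pass the test? -/
def any (p : α → Timed Bool) : List α → Timed Bool
  | [] => .pure false
  | a :: l => (p a).bind fun b => if b then .pure true else any p l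

/-- Do all elements of the list pass the test? -/
def all (p : α → Timed Bool) : List α → Timed Bool
  | [] => .pure true
  | a :: l => (p a).bind fun b => if b then all p l else .pure false

/-- The elements of the list that pass the test. -/
def filter (p : α → Timed Bool) : List α → Timed (List α)
  | [] => .pure []
  | a :: l => (p a).bind fun b => (filter p l).bind fun l' => .pure (if b then a :: l' else l')

/-- Membership in a list, at cost `w` for each comparison. -/
noncomputable def mem (w : ℕ) (a : α) (l : List α) : Timed Bool :=
  any (fun b => charge w (.pure (decide (a = b)))) l

/-- Insert an element into a duplicate-free list. -/
noncomputable def insert (w : ℕ) (a : α) (l : List α) : Timed (List α) :=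
  (mem w a l).bind fun b => charge w (.pure (if b then l else a :: l))

/-- Apply `f` to all elements of the list and collect the results without duplicates. -/
noncomputable def image (w : ℕ) (f : α → β) : List α → Timed (List β)
  | [] => .pure []
  | a :: l => (image w f l).bind fun l' => charge w (insert w (f a) l')

/-- Do something for all elements of the list, one after the other. -/
def fold (f : α → β → Timed β) : List α → β → Timed β
  | [], s => .pure s
  | a :: l, s => (f a s).bind fun s' => fold f l s'

/-- Repeat `f` a fixed number of times, at cost `w` for each round. -/
def iterate (w : ℕ) (f : α → Timed α) : ℕ → α → Timed α
  | 0, a => .pure a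
  | r + 1, a => (charge w (f a)).bind fun a' => iterate w f r a'

end Timed

/-! ### Nested fixpoints -/

/-- The least or greatest fixpoint of a monotone function on sets. -/
def FixKind.fixpoint {α : Type u} : FixKind → (Set α → Set α) → Set α
  | .mu, F => ⋂₀ {Y | F Y ⊆ Y}
  | .nu, F => ⋃₀ {Y | Y ⊆ F Y}

/-- `η_l X_l. … η_1 X_1. F(X_1, …, X_l)`, where the variables `X_i` with `i > l` are given by `X`. -/
def nestedFixpoint {α : Type u} (η : ℕ → FixKind) (F : (ℕ → Set α) → Set α) :
    ℕ → (ℕ → Set α) → Set α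
  | 0, X => F X
  | i + 1, X => (η (i + 1)).fixpoint fun Y => nestedFixpoint η F i (Function.update X (i + 1) Y)

/-- Computation of a nested fixpoint over the finite set `G` by iteration: for each variable, start
with the empty set (least fixpoints) or with `G` (greatest fixpoints) and iterate `|G|` times. -/
def computeFixpoint {α : Type u} (w : ℕ) (η : ℕ → FixKind) (F : (ℕ → List α) → Timed (List α))
    (G : List α) : ℕ → (ℕ → List α) → Timed (List α)
  | 0, X => F X
  | i + 1, X =>
      Timed.iterate w (fun Y => computeFixpoint w η F G i (Function.update X (i + 1) Y)) G.length
        (match η (i + 1) with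
          | .mu => []
          | .nu => G)

/-- `μ` for odd `i` and `ν` for even `i`. -/
def etaKind (i : ℕ) : FixKind := if i % 2 = 1 then .mu else .nu

/-- `ν` for odd `i` and `μ` for even `i`. -/
def etaKindDual (i : ℕ) : FixKind := if i % 2 = 1 then .nu else .mu

/-! ### The global caching algorithm -/

/-- The nodes of the determinized and complemented tracking automaton. -/
abbrev Node (Λ : Type u) : Type u := SafraTree (Formula Λ × ℕ)

section Labels

open scoped Classical

variable {T : Type u → Type u} [Functor T] {Λ : Type u}

/-- The label `l(v)`: the formulas in the label of the root of the tree. -/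
noncomputable def Target.label (χ : Target Λ) (v : Node Λ) : Finset (Formula Λ) :=
  χ.FL.filter fun ψ => ∃ m, (v (ψ, m)).isSome

/-- States are the nodes whose labels consist exclusively of modal literals. -/
def Target.IsState (χ : Target Λ) (v : Node Λ) : Prop := ∀ ψ ∈ χ.label v, ψ.IsModal

/-- `selections`, the sets of modal literals from `F`. -/
noncomputable def Target.selections (χ : Target Λ) : Finset (Finset (Formula Λ)) :=
  (χ.FL.filter fun ψ => ψ.IsModal).powerset

/-- Everything the algorithm depends on. -/
structure Setting (L : CoalgebraicLogic T Λ) where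
  /-- the target formula `χ` -/
  target : Target Λ
  /-- the procedure used for one-step satisfiability checking -/
  solver : OneStepSolver L (Formula Λ)
  /-- the choice of a non-modal formula `ψ_v ∈ l(v)` for each pre-state `v` -/
  pick : Node Λ → Formula Λ
  pick_mem : ∀ v, ¬ target.IsState v → pick v ∈ target.label v
  pick_nonmodal : ∀ v, ¬ target.IsState v → ¬ (pick v).IsModal
  /-- the time charged for each elementary operation on formulas, letters, labels and nodes -/
  opCost : ℕ

end Labels

/-- The configurations of the algorithm: initially; before step 1 with unexpanded nodes `U` and
expanded nodes `G`; before step 2; before step 4; after returning an answer. -/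
inductive Config (Λ : Type u) : Type u
  | start : Config Λ
  | expansion (U G : List (Node Λ)) : Config Λ
  | propagation (U G : List (Node Λ)) : Config Λ
  | final (G : List (Node Λ)) : Config Λ
  | halt (satisfiable : Bool) : Config Λ

namespace Setting

open scoped Classical

variable {T : Type u → Type u} [Functor T] {Λ : Type u} {L : CoalgebraicLogic T Λ} (P : Setting L)

/-- `n = |χ|`. -/
def n : ℕ := P.target.formula.size L.size

/-- `k = ad(χ)`. -/
def k : ℕ := P.target.formula.ad

/-- The Büchi automaton for the tracking automaton. -/
noncomputable def buchi : BuchiAutomaton (Formula Λ × ℕ) (Letter Λ) :=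
  P.target.tracking.toBuchi P.k

/-- The initial node `v_0`. -/
noncomputable def v0 : Node Λ := SafraTree.initial P.buchi

/-- The transition function of the determinized and complemented tracking automaton. -/
noncomputable def delta (v : Node Λ) (a : Letter Λ) : Node Λ :=
  SafraTree.step P.buchi (P.n * P.k) v a

/-- The priorities of the determinized tracking automaton, increased by one for complementation;
they are between `1` and `2 n k` on all nodes reachable from `v0`. -/
noncomputable def beta (v : Node Λ) (a : Letter Λ) : ℕ :=
  SafraTree.prio P.buchi (P.n * P.k) v a + 1

/-- The modal literals in the label of a state. -/
noncomputable def literals (v : Node Λ) : Finset (Λ × Formula Λ) :=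
  (P.target.label v).biUnion fun ψ =>
    match ψ with
    | .modal h φ => {(h, φ)}
    | _ => ∅

/-- The set of the labels `l(δ(v,σ))` with `σ` a selection such that `δ(v,σ) ∈ X_i` for
`i = β(v,σ)`; that is, the union of the sets `X_i(v)`. -/
def successorLabels (X : ℕ → Set (Node Λ)) (v : Node Λ) : Set (Finset (Formula Λ)) :=
  {y | ∃ σ ∈ P.target.selections,
    P.delta v (.sel σ) ∈ X (P.beta v (.sel σ)) ∧ y = P.target.label (P.delta v (.sel σ))}

/-- The function `f`. -/
def f (G : Set (Node Λ)) (X : ℕ → Set (Node Λ)) : Set (Node Λ) :=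
  {v ∈ G | ¬ P.target.IsState v ∧ ∃ a ∈ propLetters (P.pick v), P.delta v a ∈ X (P.beta v a)} ∪
  {v ∈ G | P.target.IsState v ∧ L.OneStepSat (P.literals v) (P.successorLabels X v)}

/-- The function `g`, the dual of `f` (complements are taken in the set of all nodes, so that nodes
outside of `G` are never considered unsatisfiable). -/
def g (G : Set (Node Λ)) (X : ℕ → Set (Node Λ)) : Set (Node Λ) :=
  {v ∈ G | ¬ P.target.IsState v ∧ ∀ a ∈ propLetters (P.pick v), P.delta v a ∈ X (P.beta v a)} ∪
  {v ∈ G | P.target.IsState v ∧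
    ¬ L.OneStepSat (P.literals v) (P.successorLabels (fun i => (X i)ᶜ) v)}

/-- `E_G`, a nested fixpoint with `2 n k` variables. -/
def E (G : Set (Node Λ)) : Set (Node Λ) :=
  nestedFixpoint etaKind (P.f G) (2 * P.n * P.k) fun _ => ∅

/-- `A_G`. -/
def A (G : Set (Node Λ)) : Set (Node Λ) :=
  nestedFixpoint etaKindDual (P.g G) (2 * P.n * P.k) fun _ => ∅

/-- The list of all selections. -/
noncomputable def selectionLetters : List (Letter Λ) := P.target.selections.toList.map .sel

/-- Test `δ(v,a) ∈ X_{β(v,a)}`. -/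
noncomputable def checkEdge (X : ℕ → List (Node Λ)) (v : Node Λ) (a : Letter Λ) : Timed Bool :=
  .charge P.opCost (.mem P.opCost (P.delta v a) (X (P.beta v a)))

/-- Check the one-step satisfiability of the label of the state `v` in the labels of its successors
under the letters `as`. Distinct modal literals `♥ψ` of `v` are to have distinct variables, so `♥ψ`
itself serves as the variable of `♥ψ`; it holds at the successor `u` if `ψ ∈ l(u)`. -/
noncomputable def checkState (v : Node Λ) (as : List (Letter Λ)) : Timed Bool :=
  (Timed.image P.opCost
    (fun a => (P.target.label v).filter fun θ =>
      ∃ h ψ, θ = Formula.modal h ψ ∧ ψ ∈ P.target.label (P.delta v a)) as).bind fun U =>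
  let inst : Finset (Λ × Formula Λ) := (P.literals v).image fun x => (x.1, .modal x.1 x.2)
  .charge (P.solver.steps inst U.toFinset) (.pure (P.solver.answer inst U.toFinset))

/-- Test `v ∈ f(X)`. -/
noncomputable def checkF (X : ℕ → List (Node Λ)) (v : Node Λ) : Timed Bool :=
  .charge P.opCost <|
    if P.target.IsState v then
      (Timed.filter (P.checkEdge X v) P.selectionLetters).bind fun as => P.checkState v as
    else Timed.any (P.checkEdge X v) (propLetters (P.pick v))

/-- Test `v ∈ g(X)`. -/
noncomputable def checkG (X : ℕ → List (Node Λ)) (v : Node Λ) : Timed Bool :=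
  .charge P.opCost <|
    if P.target.IsState v then
      (Timed.filter (fun a => (P.checkEdge X v a).bind fun b => .pure (!b))
        P.selectionLetters).bind fun as => (P.checkState v as).bind fun b => .pure (!b)
    else Timed.all (P.checkEdge X v) (propLetters (P.pick v))

/-- Computation of `E_G`. -/
noncomputable def computeE (G : List (Node Λ)) : Timed (List (Node Λ)) :=
  computeFixpoint P.opCost etaKind (fun X => Timed.filter (P.checkF X) G) G
    (2 * P.n * P.k) fun _ => []

/-- Computation of `A_G`. -/
noncomputable def computeA (G : List (Node Λ)) : Timed (List (Node Λ)) :=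
  computeFixpoint P.opCost etaKindDual (fun X => Timed.filter (P.checkG X) G) G
    (2 * P.n * P.k) fun _ => []

/-- The letters that are used to expand a node. -/
noncomputable def expansionLetters (v : Node Λ) : List (Letter Λ) :=
  if P.target.IsState v then P.selectionLetters else propLetters (P.pick v)

/-- Expansion of `u`: move `u` from `U` to `G`, and add to `U` those successors of `u` that have not
been expanded yet. -/
noncomputable def expand (u : Node Λ) (U G : List (Node Λ)) : Timed (Config Λ) :=
  .charge P.opCost <|
  (Timed.filter (fun x => .charge P.opCost (.pure (decide (x ≠ u)))) U).bind fun U₁ =>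
  (Timed.fold (fun a U₂ => .charge P.opCost <|
      (Timed.mem P.opCost (P.delta u a) (u :: G)).bind fun b =>
        if b then .pure U₂ else Timed.insert P.opCost (P.delta u a) U₂)
    (P.expansionLetters u) U₁).bind fun U' =>
  .pure (.propagation U' (u :: G))

/-- Go on with step 1 if there are unexpanded nodes, and with step 4 otherwise. -/
def proceed (U G : List (Node Λ)) : Config Λ :=
  match U with
  | [] => .final G
  | u :: U' => .expansion (u :: U') G

/-- If `doA` is set, compute `A_G` and return "unsatisfiable" if it contains `v_0`. -/
noncomputable def propagateA (doA : Bool) (U G : List (Node Λ)) : Timed (Config Λ) :=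
  .charge P.opCost <|
  if doA then
    (P.computeA G).bind fun Y => (Timed.mem P.opCost P.v0 Y).bind fun b =>
      .pure (if b then .halt false else proceed U G)
  else .pure (proceed U G)

/-- Optional propagation, followed by step 3; `doE` and `doA` tell whether to compute `E_G`
and `A_G`. -/
noncomputable def propagate (doE doA : Bool) (U G : List (Node Λ)) : Timed (Config Λ) :=
  if doE then
    (P.computeE G).bind fun Y => (Timed.mem P.opCost P.v0 Y).bind fun b =>
      if b then .pure (.halt true) else P.propagateA doA U G
  else P.propagateA doA U G

/-- Final propagation. -/
noncomputable def finish (G : List (Node Λ)) : Timed (Config Λ) :=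
  (P.computeE G).bind fun Y => (Timed.mem P.opCost P.v0 Y).bind fun b => .pure (.halt b)

/-- `Step c s c'`: the algorithm can move from `c` to `c'`, and this takes time `s`. The choice of
the node to be expanded and of the optional propagations is free. -/
inductive Step : Config Λ → ℕ → Config Λ → Prop
  | start : Step .start P.opCost (.expansion [P.v0] [])
  | expansion (u : Node Λ) (U G : List (Node Λ)) (mem : u ∈ U) :
      Step (.expansion U G) (P.expand u U G).time (P.expand u U G).val
  | propagation (doE doA : Bool) (U G : List (Node Λ)) :
      Step (.propagation U G) (P.propagate doE doA U G).time (P.propagate doE doA U G).val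
  | final (G : List (Node Λ)) : Step (.final G) (P.finish G).time (P.finish G).val

/-- `Run s c`: some initial segment of a run of the algorithm takes time `s` and ends in `c`. -/
inductive Run : ℕ → Config Λ → Prop
  | nil : Run 0 .start
  | cons (s s' : ℕ) (c c' : Config Λ) (run : Run s c) (step : P.Step c s' c') : Run (s + s') c'

/-- The algorithm terminates, whatever choices are made: there is no infinite run, and every run
that cannot be continued has returned an answer. -/
def Terminates : Prop :=
  (¬ ∃ c : ℕ → Config Λ, c 0 = .start ∧ ∀ i, ∃ s, P.Step (c i) s (c (i + 1))) ∧
  ∀ s c, P.Run s c → (∀ s' c', ¬ P.Step c s' c') → ∃ b, c = .halt b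

end Setting

end CoalgMu

/-! Write `q = n * k` and let `R` be the number of Safra trees that can occur. Everything rests on a
good bound for `R`.

The closure of `χ` has at most `n` elements, and the representation sizes of the operators heading
its modal literals sum to at most `n`. So there are at most `2 ^ n` selections, and each one-step
instance has size at most `n` and at most `2 ^ n` sets, once labels are restricted to the literals
of the state that they satisfy.

In a reachable tree, states in mode `0` lie in the root only, and after the vertical merge each
non-root node is the lowest position of some state. That state has one of at most `k / 2` even
modes, so there are at most `M ≤ q / 2` non-root nodes. A tree is determined by its parent function,
the lowest positions of the states in positive modes, and the set of states in mode `0`. This gives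
`R ≤ (q + 4) ^ (q + 1)` (`SafraTree.card_smallTrees_le`), an exponent close to `q`. The factor `1 /
2` is essential: with up to `q` nodes the same encoding would give about `q ^ (2 * q)`, too much for
the final estimate.

Nested iteration is correct because `f` and `g` are monotone with values inside `G`, so that `|G|`
rounds reach every least or greatest fixpoint (`computeFixpoint_val`). Monotonicity of one-step
satisfiability, and its invariance under the renaming used by the algorithm, both come from
naturality of predicate liftings (`CoalgebraicLogic.OneStepSat.map`).

One computation of a fixpoint with `2 * q` variables evaluates `f` or `g` at most `R ^ (2 * q)`
times. Each evaluation inspects at most `R` nodes, with linear searches in lists of length at most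
`R`. Each expansion moves a new node into `G`, so there are at most `R` expansions; this gives
termination and a total cost governed by `R ^ (2 * q + 3)` (`Setting.run_time_le`,
`Setting.total_cost_le`).

Up to lower-order terms in the exponent this is `q ^ (2 * q ^ 2)`, while `q! ^ (4 * q)` is at least
`q ^ (4 * q ^ 2) / 81 ^ (q ^ 2)`. The gap absorbs all exponential factors for large `q`, and the
constant absorbs the finitely many small `q` (`exists_cost_le_factorial_pow`). -/

namespace CoalgMu

open scoped Classical

/-! ### Size of the Fischer–Ladner closure -/

namespace Formula

variable {Λ : Type u}

theorem length_expansions_le (msize : Λ → ℕ) (hm : ∀ h, 0 < msize h) (φ : Formula Λ)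
    (σ : ℕ → Option (Formula Λ)) : (φ.expansions σ).length ≤ φ.size msize := by
  induction φ generalizing σ with
  | bot => simp [expansions, size]
  | top => simp [expansions, size]
  | and φ ψ ih1 ih2 =>
    have := ih1 σ; have := ih2 σ; simp [expansions, size]; omega
  | or φ ψ ih1 ih2 =>
    have := ih1 σ; have := ih2 σ; simp [expansions, size]; omega
  | modal h φ ih => have := ih σ; have := hm h; simp [expansions, size]; omega
  | var Y => simp [expansions, size]
  | fix η Y φ ih =>
    have := ih (Function.update σ Y (some ((fix η Y φ).inst σ)))
    simp [expansions, size]; omega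

/-- The representation size of the outermost modal operator, `0` if there is none. -/
def headSize (msize : Λ → ℕ) : Formula Λ → ℕ
  | modal h _ => msize h
  | _ => 0

/-- Each modal operator of `φ` heads just one entry of the list. Variables add no further literal,
since only formulas without a modal head are substituted for them; in the recursion these are
fixpoint formulas. -/
theorem sum_headSize_expansions_le (msize : Λ → ℕ) (φ : Formula Λ)
    (σ : ℕ → Option (Formula Λ)) (hσ : ∀ Y c, σ Y = some c → c.headSize msize = 0) :
    ((φ.expansions σ).map (headSize msize)).sum ≤ φ.size msize := by
  induction φ generalizing σ with
  | bot => simp [expansions, headSize]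
  | top => simp [expansions, headSize]
  | and φ ψ ih1 ih2 =>
    have := ih1 σ hσ; have := ih2 σ hσ; simp [expansions, size, inst, headSize]; omega
  | or φ ψ ih1 ih2 =>
    have := ih1 σ hσ; have := ih2 σ hσ; simp [expansions, size, inst, headSize]; omega
  | modal h φ ih => have := ih σ hσ; simp [expansions, size, inst, headSize]; omega
  | var Y =>
    cases hc : σ Y with
    | none => simp [expansions, inst, hc, headSize]
    | some c => simp [expansions, inst, hc, hσ Y c hc]
  | fix η Y φ ih =>
    have := ih (Function.update σ Y (some ((fix η Y φ).inst σ))) (by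
      intro Z c hc
      by_cases hZ : Z = Y
      · subst hZ
        simp only [Function.update_self, Option.some.injEq] at hc
        subst hc; rfl
      · rw [Function.update_of_ne hZ] at hc; exact hσ Z c hc)
    have h0 : ((fix η Y φ).inst σ).headSize msize = 0 := rfl
    simp only [expansions, size, List.map_cons, List.sum_cons, h0]; omega

theorem mem_expansions_of_mem_closure (χ : Formula Λ) (h : χ.Closed) {ψ : Formula Λ}
    (hψ : ψ ∈ χ.closure) : ψ ∈ χ.expansions fun _ => none := by
  have key := expansions_good {θ | θ ∈ χ.expansions fun _ => none} χ (fun _ => none)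
    (by simp) (fun θ hθ => hθ) (by rw [show χ.fv = ∅ from h]; simp)
  induction hψ with
  | refl => simpa only [inst_none] using inst_mem_expansions χ (fun _ => none)
  | tail _ hs ih => exact key _ ih _ hs

theorem one_le_size (msize : Λ → ℕ) (hm : ∀ h, 0 < msize h) (φ : Formula Λ) :
    1 ≤ φ.size msize := by
  cases φ with
  | modal h φ => have := hm h; simp only [size]; omega
  | _ => simp [size] <;> omega

end Formula

/-- Used with weight `1` to count the closure, and with `headSize` to bound the sizes of one-step
instances. -/
theorem sum_le_sum_map_of_subset {α : Type u} (w : α → ℕ) (l : List α) (s : Finset α)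
    (h : ∀ x ∈ s, x ∈ l) : ∑ x ∈ s, w x ≤ (l.map w).sum := by
  induction l generalizing s with
  | nil =>
    rw [Finset.eq_empty_of_forall_notMem fun x hx => List.not_mem_nil (h x hx)]; simp
  | cons a l ih =>
    have h1 := ih (s.erase a) (by
      intro x hx
      rw [Finset.mem_erase] at hx
      exact (List.mem_cons.1 (h x hx.2)).resolve_left hx.1)
    have h2 : ∑ x ∈ s, w x ≤ w a + ∑ x ∈ s.erase a, w x := by
      by_cases ha : a ∈ s
      · rw [Finset.add_sum_erase _ _ ha]
      · rw [Finset.erase_eq_of_notMem ha]; omega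
    simp only [List.map_cons, List.sum_cons]; omega

namespace Target

variable {Λ : Type u} (χ : Target Λ)

theorem mem_FL {ψ : Formula Λ} : ψ ∈ χ.FL ↔ ψ ∈ χ.formula.closure := by simp [FL]

theorem formula_mem_FL : χ.formula ∈ χ.FL := χ.mem_FL.2 .refl

theorem mem_FL_of_step {ψ ψ' : Formula Λ} (h : ψ ∈ χ.FL) (hs : Formula.FLStep ψ ψ') :
    ψ' ∈ χ.FL :=
  χ.mem_FL.2 ((χ.mem_FL.1 h).tail hs)

theorem mem_FL_of_tracks {ψ ψ' : Formula Λ} {a : Letter Λ} (h : ψ ∈ χ.FL) (ht : Tracks ψ a ψ') :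
    ψ' ∈ χ.FL := by
  cases ht with
  | other => exact h
  | sel => exact χ.mem_FL_of_step h (.modal _ _)
  | or_left => exact χ.mem_FL_of_step h (.or_left _ _)
  | or_right => exact χ.mem_FL_of_step h (.or_right _ _)
  | and_left => exact χ.mem_FL_of_step h (.and_left _ _)
  | and_right => exact χ.mem_FL_of_step h (.and_right _ _)
  | unfold => exact χ.mem_FL_of_step h (.unfold _ _ _)

theorem sum_headSize_FL_le (msize : Λ → ℕ) :
    ∑ ψ ∈ χ.FL, ψ.headSize msize ≤ χ.formula.size msize :=
  (sum_le_sum_map_of_subset _ _ _ fun _ hψ =>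
    Formula.mem_expansions_of_mem_closure _ χ.closed (χ.mem_FL.1 hψ)).trans
    (Formula.sum_headSize_expansions_le msize _ _ (by simp))

theorem card_FL_le (msize : Λ → ℕ) (hm : ∀ h, 0 < msize h) :
    χ.FL.card ≤ χ.formula.size msize := by
  have h := sum_le_sum_map_of_subset (fun _ => 1) _ χ.FL fun _ hψ =>
    Formula.mem_expansions_of_mem_closure _ χ.closed (χ.mem_FL.1 hψ)
  simp only [Finset.sum_const, List.map_const', List.sum_replicate, smul_eq_mul, mul_one] at h
  exact h.trans (Formula.length_expansions_le msize hm _ _)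

end Target

/-! ### Paths in Safra trees -/

namespace SafraTree

/-- `PathTo par j π`: `π` lists the ancestors of `j` in the tree with parent function `par` and
root `0`, from the child of the root down to `j`. -/
inductive PathTo (par : ℕ → ℕ) : ℕ → List ℕ → Prop
  | nil : PathTo par 0 []
  | snoc (j : ℕ) (π : List ℕ) (h : PathTo par (par j) π) (lt : par j < j) : PathTo par j (π ++ [j])

namespace PathTo

variable {par : ℕ → ℕ}

/-- Parents have smaller names, so the root `0` has only the empty path and every other node
continues to its parent. Hence a position in the tree can be stored as its last node. -/
theorem unique {j : ℕ} {π π' : List ℕ} (h : PathTo par j π) (h' : PathTo par j π') : π = π' := by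
  induction h generalizing π' with
  | nil =>
    cases h' with
    | nil => rfl
    | snoc _ _ _ lt => exact absurd lt (Nat.not_lt_zero _)
  | snoc j π h lt ih =>
    cases h' with
    | nil => exact absurd lt (Nat.not_lt_zero _)
    | snoc _ π' h' lt' => rw [ih h']

theorem getLastD_eq {j : ℕ} {π : List ℕ} (h : PathTo par j π) : π.getLastD 0 = j := by
  cases h <;> simp

theorem mem_bounds {j : ℕ} {π : List ℕ} (h : PathTo par j π) : ∀ i ∈ π, 0 < i ∧ i ≤ j := by
  induction h with
  | nil => simp
  | snoc j π h lt ih =>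
    intro i hi
    rcases List.mem_append.1 hi with hi | hi
    · exact ⟨(ih i hi).1, (ih i hi).2.trans lt.le⟩
    · rw [List.mem_singleton.1 hi]; exact ⟨Nat.zero_lt_of_lt lt, le_rfl⟩

theorem congr {par' : ℕ → ℕ} {j : ℕ} {π : List ℕ} (h : PathTo par j π)
    (hp : ∀ i ∈ π, par' i = par i) : PathTo par' j π := by
  induction h with
  | nil => exact .nil
  | snoc j π h lt ih =>
    have e : par' j = par j := hp j (by simp)
    exact .snoc j π (e ▸ ih fun i hi => hp i (by simp [hi])) (e ▸ lt)

theorem parent_mem {j : ℕ} {π : List ℕ} (h : PathTo par j π) :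
    ∀ i ∈ π, par i < i ∧ (par i = 0 ∨ par i ∈ π) := by
  induction h with
  | nil => simp
  | snoc j π h lt ih =>
    intro i hi
    rcases List.mem_append.1 hi with hi | hi
    · refine ⟨(ih i hi).1, (ih i hi).2.imp_right fun h => by simp [h]⟩
    · rw [List.mem_singleton.1 hi]
      refine ⟨lt, ?_⟩
      generalize par j = i at *
      cases h <;> simp

/-- Renaming of nodes along a strictly monotone function. -/
theorem map {j : ℕ} {π : List ℕ} (h : PathTo par j π) (par' r : ℕ → ℕ) (h0 : r 0 = 0)
    (hr : ∀ i ∈ π, par' (r i) = r (par i) ∧ r (par i) < r i) : PathTo par' (r j) (π.map r) := by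
  induction h with
  | nil => rw [h0]; exact .nil
  | snoc j π h lt ih =>
    obtain ⟨h1, h2⟩ := hr j (by simp)
    rw [List.map_append]
    exact .snoc _ _ (h1 ▸ ih fun i hi => hr i (by simp [hi])) (h1 ▸ h2)

end PathTo

theorem cut_append_of_mem {g : Set ℕ} {π : List ℕ} (ρ : List ℕ) (h : ∃ i ∈ π, i ∈ g) :
    cut g (π ++ ρ) = cut g π := by
  induction π with
  | nil => simp at h
  | cons a π ih =>
    by_cases ha : a ∈ g
    · simp [cut, ha]
    · simp only [List.mem_cons, exists_eq_or_imp, ha, false_or] at h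
      simp [cut, ha, ih h]

theorem cut_eq_self {g : Set ℕ} {π : List ℕ} (h : ∀ i ∈ π, i ∉ g) : cut g π = π := by
  induction π with
  | nil => rfl
  | cons a π ih =>
    simp only [List.mem_cons, forall_eq_or_imp] at h
    simp [cut, h.1, ih h.2]

/-- Nothing is assumed about `j`, because the first element from `g` survives the cut. -/
theorem cut_append_singleton {g : Set ℕ} {π : List ℕ} (j : ℕ) (h : ∀ i ∈ π, i ∉ g) :
    cut g (π ++ [j]) = π ++ [j] := by
  induction π with
  | nil => simp [cut]
  | cons a π ih =>
    simp only [List.mem_cons, forall_eq_or_imp] at h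
    simp [cut, h.1, ih h.2]

/-- Cutting a path gives a path; a node of the cut path comes after nodes outside of `g` only. -/
theorem PathTo.cut {par : ℕ → ℕ} {g : Set ℕ} {j : ℕ} {π : List ℕ} (h : PathTo par j π) :
    (∃ i, PathTo par i (cut g π)) ∧
      ∀ i ∈ SafraTree.cut g π, ∃ ρ, PathTo par i ρ ∧ SafraTree.cut g ρ = ρ ∧
        (i ∈ g → ρ = SafraTree.cut g π) := by
  induction h with
  | nil => exact ⟨⟨0, .nil⟩, by simp [SafraTree.cut]⟩
  | snoc j π h lt ih =>
    by_cases hg : ∃ i ∈ π, i ∈ g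
    · rw [cut_append_of_mem _ hg]; exact ih
    · push Not at hg
      have e := cut_append_singleton (g := g) j hg
      have hj := PathTo.snoc j π h lt
      rw [e]
      refine ⟨⟨j, hj⟩, fun i hi => ?_⟩
      by_cases hij : i = j
      · subst hij; exact ⟨_, hj, e, fun _ => rfl⟩
      · have hi : i ∈ π := by simpa [hij] using hi
        obtain ⟨ρ, h1, h2, h3⟩ := ih.2 i (by rwa [cut_eq_self hg])
        exact ⟨ρ, h1, h2, fun hig => absurd hig (hg i hi)⟩

/-! ### The invariant of reachable Safra trees -/

/-- The positive even numbers up to `k`. -/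
def evens (k : ℕ) : Finset ℕ := (Finset.range (k / 2)).image fun i => 2 * (i + 1)

theorem mem_evens {k m : ℕ} : m ∈ evens k ↔ Even m ∧ 2 ≤ m ∧ m ≤ k := by
  simp only [evens, Finset.mem_image, Finset.mem_range]
  constructor
  · rintro ⟨i, hi, rfl⟩
    exact ⟨⟨i + 1, by ring⟩, by omega, by omega⟩
  · rintro ⟨⟨c, hc⟩, h2, hk⟩
    exact ⟨c - 1, by omega, by omega⟩

theorem card_evens_le (k : ℕ) : (evens k).card ≤ k / 2 :=
  Finset.card_image_le.trans (by simp)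

variable {Q A : Type u}

/-- The nodes of `t` form a tree with parent function `par`, its states come from `F` and have mode
`0` or an even mode up to `k`, and states in mode `0` occur in the root only. -/
def IsTree (F : Finset Q) (k : ℕ) (par : ℕ → ℕ) (t : SafraTree (Q × ℕ)) : Prop :=
  ∀ q π, t q = some π →
    q.1 ∈ F ∧ (q.2 = 0 ∧ π = [] ∨ q.2 ∈ evens k) ∧ ∃ j, PathTo par j π

/-- Trees over `F` whose nodes have names up to the number of states in a positive mode. -/
def IsSmall (F : Finset Q) (k : ℕ) (t : SafraTree (Q × ℕ)) : Prop :=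
  ∃ par, IsTree F k par t ∧ ∀ j ∈ t.names, j ≤ F.card * (k / 2)

theorem IsTree.pruned {F : Finset Q} {k : ℕ} {par : ℕ → ℕ} {t : SafraTree (Q × ℕ)}
    (h : IsTree F k par t) : IsTree F k par t.pruned := by
  intro q π hq
  obtain ⟨ρ, hρ, rfl⟩ := Option.map_eq_some_iff.1 hq
  obtain ⟨h1, h2, j, hj⟩ := h q ρ hρ
  refine ⟨h1, h2.imp_left fun h => ⟨h.1, by simp [h.2, SafraTree.cut]⟩, hj.cut.1⟩

/-- After vertical merge, each node has a state of its own. -/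
theorem IsTree.exists_last {F : Finset Q} {k : ℕ} {par : ℕ → ℕ} {t : SafraTree (Q × ℕ)}
    (h : IsTree F k par t) {j : ℕ} (hj : j ∈ t.pruned.names) :
    ∃ q ∈ F ×ˢ evens k, ((t.pruned q).getD []).getLastD 0 = j := by
  suffices ∃ q π, t.pruned q = some π ∧ PathTo par j π by
    obtain ⟨q, π, hq, hπ⟩ := this
    obtain ⟨h1, h2, -⟩ := h.pruned q π hq
    refine ⟨q, Finset.mem_product.2 ⟨h1, ?_⟩, by rw [hq]; exact hπ.getLastD_eq⟩
    -- A state in mode `0` sits in the root, whereas `j` occurs on a path and is therefore positive.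
    refine h2.resolve_left fun h0 => ?_
    obtain ⟨q', π', hq', hj'⟩ := hj
    obtain ⟨-, -, i, hi⟩ := h.pruned q' π' hq'
    have := (hi.mem_bounds j hj').1
    rw [h0.2] at hπ
    have := hπ.getLastD_eq
    simp at this
    omega
  obtain ⟨q, π', hq, hjπ⟩ := hj
  obtain ⟨π, hπ, rfl⟩ := Option.map_eq_some_iff.1 hq
  obtain ⟨-, -, i, hi⟩ := h q π hπ
  obtain ⟨ρ, hρ, hcut, hg⟩ := hi.cut.2 j hjπ
  -- If `j` is green, the cut path already ends in `j`. Otherwise, by definition of green, some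
  -- state has `j` as its lowest node; no earlier node on its path is green, so the cut leaves it
  -- there.
  by_cases hjg : j ∈ t.green
  · exact ⟨q, _, hq, hg hjg ▸ hρ⟩
  · have hn : j ∈ t.names := by
      refine ⟨q, π, hπ, ?_⟩
      have hsub : ∀ l : List ℕ, ∀ x ∈ cut t.green l, x ∈ l := by
        intro l
        induction l with
        | nil => simp [SafraTree.cut]
        | cons a l ih =>
          intro x hx
          by_cases ha : a ∈ t.green
          · simp only [SafraTree.cut, ha, if_true, List.mem_singleton] at hx
            simp [hx]
          · simp only [SafraTree.cut, ha, if_false, List.mem_cons] at hx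
            exact List.mem_cons.2 (hx.imp_right (ih x))
      exact hsub π j hjπ
    simp only [green, Set.mem_ofPred_eq, hn, true_and, not_forall, not_not] at hjg
    obtain ⟨q₂, π₂, hq₂, hl⟩ := hjg
    obtain ⟨-, -, i₂, hi₂⟩ := h q₂ π₂ hq₂
    have e : i₂ = j := by
      rw [← hi₂.getLastD_eq, List.getLastD_eq_getLast?, hl]; rfl
    subst e
    have e2 := hi₂.unique hρ
    subst e2
    exact ⟨q₂, π₂, by simp [SafraTree.pruned, hq₂, hcut], hi₂⟩

theorem IsTree.names_pruned_subset {F : Finset Q} {k : ℕ} {par : ℕ → ℕ} {t : SafraTree (Q × ℕ)}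
    (h : IsTree F k par t) :
    t.pruned.names ⊆ ((F ×ˢ evens k).image fun q => ((t.pruned q).getD []).getLastD 0 : Finset ℕ) :=
  fun _ hj => by simpa using h.exists_last hj

theorem IsTree.renamed {F : Finset Q} {k : ℕ} {par : ℕ → ℕ} {t : SafraTree (Q × ℕ)}
    (h : IsTree F k par t) (hfin : t.names.Finite) (hcard : t.names.ncard ≤ F.card * (k / 2)) :
    IsSmall F k t.renamed := by
  set r : ℕ → ℕ := fun j => Set.ncard {i ∈ t.names | i ≤ j} with hr
  have hpos : ∀ i ∈ t.names, 0 < i := by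
    rintro i ⟨q, π, hq, hi⟩
    obtain ⟨-, -, j, hj⟩ := h q π hq
    exact (hj.mem_bounds i hi).1
  -- Only the larger number has to be a name: the smaller one will be a parent, possibly the root
  -- `0`.
  have hmono : ∀ i j, i < j → j ∈ t.names → r i < r j := by
    intro i j hij hj
    refine Set.ncard_lt_ncard ⟨fun x hx => ⟨hx.1, hx.2.trans hij.le⟩, fun hs => ?_⟩
      (hfin.subset fun x hx => hx.1)
    exact absurd (hs ⟨hj, le_rfl⟩).2 (by omega)
  have hinj : ∀ i ∈ t.names, ∀ j ∈ t.names, r i = r j → i = j := by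
    intro i hi j hj e
    rcases lt_trichotomy i j with hij | hij | hij
    · exact absurd e (hmono i j hij hj).ne
    · exact hij
    · exact absurd e (hmono j i hij hi).ne'
  have h0 : r 0 = 0 := by
    have : {i ∈ t.names | i ≤ 0} = ∅ := by
      ext i
      simp only [Set.mem_ofPred_eq, Set.mem_empty_iff_false, iff_false, not_and]
      intro hi; have := hpos i hi; omega
    simp only [hr, this, Set.ncard_empty]
  -- The old parent function transported along the ranking `r`, which is injective on names.
  refine ⟨fun m => if hm : ∃ j ∈ t.names, r j = m then r (par hm.choose) else 0, ?_, ?_⟩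
  · intro q π hq
    obtain ⟨ρ, hρ, rfl⟩ := Option.map_eq_some_iff.1 hq
    obtain ⟨h1, h2, j, hj⟩ := h q ρ hρ
    refine ⟨h1, h2.imp_left fun h => ⟨h.1, by simp [h.2]⟩, r j, hj.map _ r h0 fun i hi => ?_⟩
    have hi' : i ∈ t.names := ⟨q, ρ, hρ, hi⟩
    refine ⟨?_, hmono _ _ (hj.parent_mem i hi).1 hi'⟩
    have hm : ∃ j ∈ t.names, r j = r i := ⟨i, hi', rfl⟩
    rw [dif_pos hm, hinj _ hm.choose_spec.1 _ hi' hm.choose_spec.2]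
  · rintro j ⟨q, π, hq, hj⟩
    obtain ⟨ρ, hρ, rfl⟩ := Option.map_eq_some_iff.1 hq
    obtain ⟨i, -, rfl⟩ := List.mem_map.1 hj
    exact (Set.ncard_le_ncard (fun x hx => hx.1) hfin).trans hcard

/-- The new child of a node `j` is named `N + 1 + j`, which no old node can be, so subtracting `N +
1` recovers its parent. Transitions from mode `0` never accept, hence mode `0` does not leave the
root, and a positive mode never changes. -/
theorem IsTree.merged {F : Finset Q} {k N : ℕ} {par : ℕ → ℕ} {t : SafraTree (Q × ℕ)}
    (P : ParityAutomaton Q A) (h : IsTree F k par t) (hN : ∀ j ∈ t.names, j ≤ N) (a : A)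
    (hF : ∀ q ∈ F, ∀ q', P.trans q a q' → q' ∈ F) :
    IsTree F k (fun j => if j ≤ N then par j else j - (N + 1)) (t.merged (P.toBuchi k) N a) := by
  intro q' ρ hq'
  unfold SafraTree.merged at hq'
  split_ifs at hq' with hex
  obtain rfl := Option.some.inj hq'
  obtain ⟨⟨q, π, hq, ⟨htr, hmode⟩, hρ⟩, -⟩ := hex.choose_spec
  generalize hex.choose = ρ at *
  subst hρ
  obtain ⟨h1, h2, j, hj⟩ := h q π hq
  refine ⟨hF _ h1 _ htr, ?_, ?_⟩
  · rcases h2 with ⟨h2, rfl⟩ | h2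
    · have hna : ¬ (P.toBuchi k).acc q a q' := fun hacc => hacc.1 h2
      rcases hmode with ⟨-, h3 | h3⟩ | ⟨h3, -⟩
      · exact Or.inl ⟨h3, by rw [if_neg hna]⟩
      · exact Or.inr (mem_evens.2 h3)
      · exact absurd h2 h3
    · rcases hmode with ⟨h3, -⟩ | ⟨-, h3, -⟩
      · exact absurd (mem_evens.1 h2).2.1 (by omega)
      · exact Or.inr (h3 ▸ h2)
  · have hj' : PathTo (fun j => if j ≤ N then par j else j - (N + 1)) j π :=
      hj.congr fun i hi => if_pos (hN i ⟨q, π, hq, hi⟩)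
    split_ifs with hacc
    · rw [hj.getLastD_eq]
      have e : (fun j => if j ≤ N then par j else j - (N + 1)) (N + 1 + j) = j := by
        simp only; rw [if_neg (by omega)]; omega
      exact ⟨_, .snoc _ _ ((congrArg (fun i => PathTo _ i π) e).mpr hj') (e.trans_lt (by omega))⟩
    · exact ⟨j, hj'⟩

/-- The intermediate tree may use names above `N`, but after pruning every name is the last node of
a state in `F ×ˢ evens k`; renaming then brings the names back below the number of such states. -/
theorem IsSmall.step {F : Finset Q} {k N : ℕ} {t : SafraTree (Q × ℕ)}
    (P : ParityAutomaton Q A) (h : IsSmall F k t) (hN : F.card * (k / 2) ≤ N) (a : A)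
    (hF : ∀ q ∈ F, ∀ q', P.trans q a q' → q' ∈ F) : IsSmall F k (t.step (P.toBuchi k) N a) := by
  obtain ⟨par, ht, hn⟩ := h
  have hm := ht.merged P (fun j hj => (hn j hj).trans hN) a hF
  have hsub := hm.names_pruned_subset
  refine hm.pruned.renamed ((Finset.finite_toSet _).subset hsub) ?_
  refine (Set.ncard_le_ncard hsub (Finset.finite_toSet _)).trans ?_
  rw [Set.ncard_coe_finset]
  refine Finset.card_image_le.trans ?_
  rw [Finset.card_product]
  exact Nat.mul_le_mul le_rfl (card_evens_le k)

theorem isSmall_initial {F : Finset Q} {k : ℕ} (P : ParityAutomaton Q A) (h : P.init ∈ F) :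
    IsSmall F k (initial (P.toBuchi k)) := by
  refine ⟨id, fun q π hq => ?_, ?_⟩
  · unfold initial at hq
    split_ifs at hq with hi
    obtain rfl := Option.some.inj hq
    subst hi
    exact ⟨h, Or.inl ⟨rfl, rfl⟩, 0, .nil⟩
  · rintro j ⟨q, π, hq, hj⟩
    unfold initial at hq
    split_ifs at hq with hi
    obtain rfl := Option.some.inj hq
    simp at hj

/-! ### Counting Safra trees -/

/-- The tree with a given parent function, a given set of states in mode `0`, and given lowest
positions of the states in a positive mode. -/
noncomputable def decode {F : Finset Q} {k M : ℕ}
    (c : (Fin (M + 1) → Fin (M + 1)) × (↥(F ×ˢ evens k) → Option (Fin (M + 1))) × ↥F.powerset) :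
    SafraTree (Q × ℕ) := fun q =>
  if q.2 = 0 then if q.1 ∈ c.2.2.1 then some [] else none
  else if hq : q ∈ F ×ˢ evens k then
    (c.2.1 ⟨q, hq⟩).bind fun j =>
      if h : ∃ π, PathTo (fun i => if hi : i < M + 1 then (c.1 ⟨i, hi⟩ : ℕ) else 0) j π
      then some h.choose else none
  else none

theorem IsSmall.exists_decode {F : Finset Q} {k : ℕ} {t : SafraTree (Q × ℕ)} (h : IsSmall F k t) :
    ∃ c, decode (F := F) (k := k) (M := F.card * (k / 2)) c = t := by
  obtain ⟨par, ht, hn⟩ := h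
  set M := F.card * (k / 2) with hM
  have hlast : ∀ q π, t q = some π → π.getLastD 0 < M + 1 := by
    intro q π hq
    rcases List.eq_nil_or_concat π with rfl | ⟨ρ, j, rfl⟩
    · simp
    · have := hn j ⟨q, _, hq, by simp⟩
      simp; omega
  -- The minimum only serves to land in `Fin (M + 1)`: on the paths of `t` all names are at most `M`
  -- and parents are smaller, so nothing is truncated there.
  refine ⟨(fun i => ⟨min (par i) M, by omega⟩,
    fun q => (t q.1).pmap (fun π (hπ : t q.1 = some π) => ⟨π.getLastD 0, hlast _ _ hπ⟩)
      (fun π hπ => hπ),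
    ⟨F.filter fun x => (t (x, 0)).isSome, Finset.mem_powerset.2 (Finset.filter_subset _ _)⟩), ?_⟩
  funext q
  obtain ⟨x, m⟩ := q
  unfold decode
  cases hq : t (x, m) with
  | none =>
    simp only
    split_ifs with h0 h1 h2
    · subst h0; simp [hq] at h1
    · rfl
    · rw [Option.bind_eq_none_iff]
      intro j hj
      simp [hq] at hj
    · rfl
  | some π =>
    obtain ⟨h1, h2, j, hj⟩ := ht _ _ hq
    by_cases h0 : m = 0
    · subst h0
      have h2 : π = [] := by
        rcases h2 with h2 | h2
        · exact h2.2
        · exact absurd (mem_evens.1 h2).2.1 (by simp)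
      simp only [if_true]
      rw [if_pos (by simp only [Finset.mem_filter, hq]; exact ⟨h1, rfl⟩), h2]
    · have hm : (x, m) ∈ F ×ˢ evens k :=
        Finset.mem_product.2 ⟨h1, h2.resolve_left fun h => h0 h.1⟩
      have hp : PathTo (fun i => if hi : i < M + 1 then min (par i) M else 0) j π := by
        refine hj.congr fun i hi => ?_
        have hiM := hn i ⟨_, π, hq, hi⟩
        have hlt := (hj.parent_mem i hi).1
        rw [dif_pos (by omega)]; omega
      have he : ∃ π, PathTo (fun i => if hi : i < M + 1 then min (par i) M else 0) j π := ⟨π, hp⟩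
      simp only
      rw [if_neg h0, dif_pos hm, Option.bind_eq_some_iff]
      refine ⟨⟨j, hj.getLastD_eq ▸ hlast _ _ hq⟩, ?_, ?_⟩
      · rw [Option.pmap_eq_some_iff]
        exact ⟨π, hq, hq, Fin.ext hj.getLastD_eq.symm⟩
      · simp only
        rw [dif_pos he]
        exact congrArg some (he.choose_spec.unique hp)

/-- The small trees over `F`. -/
noncomputable def smallTrees (F : Finset Q) (k : ℕ) : Finset (SafraTree (Q × ℕ)) :=
  Finset.univ.image (decode (F := F) (k := k) (M := F.card * (k / 2)))

theorem IsSmall.mem_smallTrees {F : Finset Q} {k : ℕ} {t : SafraTree (Q × ℕ)}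
    (h : IsSmall F k t) : t ∈ smallTrees F k := by
  obtain ⟨c, hc⟩ := h.exists_decode
  exact Finset.mem_image.2 ⟨c, Finset.mem_univ _, hc⟩

theorem card_smallTrees_le (F : Finset Q) (k n : ℕ) (hk : 1 ≤ k) (hF : F.card ≤ n) :
    (smallTrees F k).card ≤ (n * k + 4) ^ (n * k + 1) := by
  set M := F.card * (k / 2) with hM
  have hM2 : 2 * M ≤ n * k := by
    calc 2 * M = F.card * (2 * (k / 2)) := by rw [hM]; ring
      _ ≤ n * k := Nat.mul_le_mul hF (Nat.mul_div_le k 2)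
  have hE : (F ×ˢ evens k).card ≤ M := by
    rw [Finset.card_product]; exact Nat.mul_le_mul le_rfl (card_evens_le k)
  have hFq : F.card ≤ n * k := hF.trans (Nat.le_mul_of_pos_right n hk)
  refine Finset.card_image_le.trans ?_
  rw [Finset.card_univ]
  simp only [Fintype.card_prod, Fintype.card_fun, Fintype.card_fin, Fintype.card_option,
    Fintype.card_coe, Finset.card_powerset]
  -- The factors count parent functions, lowest positions (including absence) of states in positive
  -- modes, and sets of states in mode `0`. The first two exponents add up to `2 * M + 1`, at most
  -- `n * k + 1`.
  calc (M + 1) ^ (M + 1) * ((M + 1 + 1) ^ (F ×ˢ evens k).card * 2 ^ F.card)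
      ≤ (M + 2) ^ (M + 1) * ((M + 2) ^ M * 2 ^ (n * k)) := by
        gcongr <;> omega
    _ = (M + 2) ^ (2 * M + 1) * 2 ^ (n * k) := by rw [two_mul]; ring
    _ ≤ (M + 2) ^ (n * k + 1) * 2 ^ (n * k + 1) := by
        gcongr <;> omega
    _ = ((M + 2) * 2) ^ (n * k + 1) := by rw [mul_pow]
    _ ≤ _ := Nat.pow_le_pow_left (by omega) _

end SafraTree

/-! ### Values and running times of the program combinators -/

namespace Timed

universe v

variable {α : Type u} {β : Type v}

theorem any_val (p : α → Timed Bool) (l : List α) :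
    (any p l).val = true ↔ ∃ a ∈ l, (p a).val = true := by
  induction l with
  | nil => simp [any, Timed.pure]
  | cons a l ih =>
    cases h : (p a).val <;> simp [any, Timed.bind, h, Timed.pure, ih]

theorem all_val (p : α → Timed Bool) (l : List α) :
    (all p l).val = true ↔ ∀ a ∈ l, (p a).val = true := by
  induction l with
  | nil => simp [all, Timed.pure]
  | cons a l ih =>
    cases h : (p a).val <;> simp [all, Timed.bind, h, Timed.pure, ih]

theorem filter_val (p : α → Timed Bool) (l : List α) :
    (filter p l).val = l.filter fun a => (p a).val := by
  induction l with
  | nil => rfl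
  | cons a l ih =>
    cases h : (p a).val <;> simp [filter, Timed.bind, h, Timed.pure, ih]

theorem any_time_le (p : α → Timed Bool) (l : List α) (c : ℕ) (h : ∀ a ∈ l, (p a).time ≤ c) :
    (any p l).time ≤ l.length * c := by
  induction l with
  | nil => simp [any, Timed.pure]
  | cons a l ih =>
    simp only [List.mem_cons, forall_eq_or_imp] at h
    have := ih h.2
    rw [List.length_cons, Nat.succ_mul]
    cases hb : (p a).val <;> simp [any, Timed.bind, hb, Timed.pure] <;> omega

theorem all_time_le (p : α → Timed Bool) (l : List α) (c : ℕ) (h : ∀ a ∈ l, (p a).time ≤ c) :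
    (all p l).time ≤ l.length * c := by
  induction l with
  | nil => simp [all, Timed.pure]
  | cons a l ih =>
    simp only [List.mem_cons, forall_eq_or_imp] at h
    have := ih h.2
    rw [List.length_cons, Nat.succ_mul]
    cases hb : (p a).val <;> simp [all, Timed.bind, hb, Timed.pure] <;> omega

theorem filter_time_le (p : α → Timed Bool) (l : List α) (c : ℕ) (h : ∀ a ∈ l, (p a).time ≤ c) :
    (filter p l).time ≤ l.length * c := by
  induction l with
  | nil => simp [filter, Timed.pure]
  | cons a l ih =>
    simp only [List.mem_cons, forall_eq_or_imp] at h
    have := ih h.2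
    rw [List.length_cons, Nat.succ_mul]
    simp [filter, Timed.bind, Timed.pure]; omega

theorem mem_val (w : ℕ) (a : α) (l : List α) : (mem w a l).val = true ↔ a ∈ l := by
  simp [mem, any_val, charge, Timed.pure]

theorem mem_time_le (w : ℕ) (a : α) (l : List α) : (mem w a l).time ≤ l.length * w :=
  any_time_le _ _ _ fun b _ => by simp [charge, Timed.pure]

theorem insert_val (w : ℕ) (a : α) (l : List α) :
    (insert w a l).val = if a ∈ l then l else a :: l := by
  simp only [insert, Timed.bind, charge, Timed.pure, mem_val]

theorem insert_time_le (w : ℕ) (a : α) (l : List α) :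
    (insert w a l).time ≤ (l.length + 1) * w := by
  have := mem_time_le w a l
  simp only [insert, Timed.bind, charge, Timed.pure]
  rw [Nat.succ_mul]; omega

theorem mem_image_val (w : ℕ) (f : α → β) (l : List α) (b : β) :
    b ∈ (image w f l).val ↔ ∃ a ∈ l, f a = b := by
  induction l with
  | nil => simp [image, Timed.pure]
  | cons a l ih =>
    simp only [image, Timed.bind, charge, insert_val, List.mem_cons, exists_eq_or_imp, ← ih]
    split_ifs with h
    · constructor
      · exact Or.inr
      · rintro (rfl | h')
        exacts [h, h']
    · simp [eq_comm]

theorem image_length_le (w : ℕ) (f : α → β) (l : List α) :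
    (image w f l).val.length ≤ l.length := by
  induction l with
  | nil => simp [image, Timed.pure]
  | cons a l ih =>
    simp only [image, Timed.bind, charge, insert_val, List.length_cons]
    split_ifs
    · omega
    · simpa using ih

theorem image_time_le (w : ℕ) (f : α → β) (l : List α) :
    (image w f l).time ≤ l.length * ((l.length + 1) * w) := by
  induction l with
  | nil => simp [image, Timed.pure]
  | cons a l ih =>
    have h1 := insert_time_le w (f a) (image w f l).val
    have h2 : ((image w f l).val.length + 1) * w ≤ (l.length + 1) * w :=
      Nat.mul_le_mul_right _ (Nat.succ_le_succ (image_length_le w f l))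
    simp only [image, Timed.bind, charge, List.length_cons]
    calc (image w f l).time + (w + (insert w (f a) (image w f l).val).time)
        ≤ l.length * ((l.length + 1) * w) + (w + (l.length + 1) * w) := by omega
      _ ≤ l.length * ((l.length + 1 + 1) * w) + (l.length + 1 + 1) * w := by
          gcongr
          · omega
          · rw [Nat.succ_mul (l.length + 1)]; omega
      _ = _ := by ring

/-- The cost of a round depends on the current state, so it is bounded jointly with an invariant
`p`. -/
theorem fold_le {f : α → β → Timed β} (p : β → Prop) (c : ℕ) (l : List α)
    (h : ∀ a ∈ l, ∀ s, p s → p (f a s).val ∧ (f a s).time ≤ c) (s : β) (hs : p s) :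
    p (fold f l s).val ∧ (fold f l s).time ≤ l.length * c := by
  induction l generalizing s with
  | nil => simpa [fold, Timed.pure] using hs
  | cons a l ih =>
    simp only [List.mem_cons, forall_eq_or_imp] at h
    have h1 := h.1 s hs
    have h2 := ih h.2 _ h1.1
    refine ⟨h2.1, ?_⟩
    simp only [fold, Timed.bind, List.length_cons]
    rw [Nat.succ_mul]; omega

theorem iterate_val (w : ℕ) (f : α → Timed α) (r : ℕ) (a : α) :
    (iterate w f r a).val = (fun a => (f a).val)^[r] a := by
  induction r generalizing a with
  | zero => rfl
  | succ r ih => simp [iterate, Timed.bind, charge, ih]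

theorem iterate_le (w : ℕ) {f : α → Timed α} (p : α → Prop) (c r : ℕ)
    (h : ∀ a, p a → p (f a).val ∧ (f a).time ≤ c) (a : α) (ha : p a) :
    p (iterate w f r a).val ∧ (iterate w f r a).time ≤ r * (w + c) := by
  induction r generalizing a with
  | zero => simpa [iterate, Timed.pure] using ha
  | succ r ih =>
    have h1 := h a ha
    have h2 := ih _ h1.1
    refine ⟨h2.1, ?_⟩
    simp only [iterate, Timed.bind, charge]
    rw [Nat.succ_mul]; omega

end Timed

/-! ### Nested fixpoints by iteration -/

section Fixpoints

variable {α : Type u}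

theorem iterate_empty_eq_lfp {F : Set α → Set α} (hF : Monotone F) {G : Set α} (hG : G.Finite)
    (hFG : ∀ Y, F Y ⊆ G) {r : ℕ} (hr : G.ncard ≤ r) : F^[r] ∅ = FixKind.mu.fixpoint F := by
  have hfin : ∀ i, (F^[i + 1] ∅).Finite := fun i =>
    hG.subset (by rw [Function.iterate_succ_apply']; exact hFG _)
  have hmono : ∀ i, F^[i] ∅ ⊆ F^[i + 1] ∅ := by
    intro i
    induction i with
    | zero => simp
    | succ i ih =>
      rw [Function.iterate_succ_apply', Function.iterate_succ_apply' (n := i + 1)]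
      exact hF ih
  -- An equality anywhere in the chain persists. So if the chain still grows at step `i`, all
  -- earlier inclusions were strict and each added an element; this cannot go on beyond `|G|`.
  have key : ∀ i, F^[i + 1] ∅ = F^[i] ∅ ∨ i + 1 ≤ (F^[i + 1] ∅).ncard := by
    intro i
    by_cases he : F^[i + 1] ∅ = F^[i] ∅
    · exact Or.inl he
    refine Or.inr ?_
    have hlt : ∀ j, j ≤ i → F^[j] ∅ ⊂ F^[j + 1] ∅ := by
      intro j hj
      refine (hmono j).ssubset_of_ne fun h => he ?_
      obtain ⟨d, rfl⟩ := Nat.exists_eq_add_of_le hj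
      have : ∀ d, F^[j + d + 1] ∅ = F^[j + d] ∅ := by
        intro d
        induction d with
        | zero => exact h.symm
        | succ d ih =>
          rw [Function.iterate_succ_apply', ← add_assoc, ih, ← Function.iterate_succ_apply' F]
          exact ih
      exact this d
    have : ∀ j, j ≤ i → j + 1 ≤ (F^[j + 1] ∅).ncard := by
      intro j
      induction j with
      | zero =>
        intro hj
        have := Set.ncard_lt_ncard (hlt 0 hj) (hfin 0)
        omega
      | succ j ih =>
        intro hj
        have := Set.ncard_lt_ncard (hlt (j + 1) hj) (hfin (j + 1))
        have := ih (by omega)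
        omega
    exact this i le_rfl
  have hfix : F^[r + 1] ∅ = F^[r] ∅ := by
    refine (key r).resolve_right fun h => ?_
    have : (F^[r + 1] ∅).ncard ≤ G.ncard :=
      Set.ncard_le_ncard (by rw [Function.iterate_succ_apply']; exact hFG _) hG
    omega
  rw [Function.iterate_succ_apply'] at hfix
  refine Set.Subset.antisymm (Set.subset_sInter fun Y hY => ?_) (Set.sInter_subset_of_mem hfix.le)
  have : ∀ i, F^[i] ∅ ⊆ Y := by
    intro i
    induction i with
    | zero => simp
    | succ i ih =>
      rw [Function.iterate_succ_apply']
      exact (hF ih).trans hY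
  exact this r

/-- As `F` takes values inside `G`, every post-fixpoint lies in `G`, and `G` can replace the set of
all elements as the starting point of a decreasing chain. -/
theorem iterate_eq_gfp {F : Set α → Set α} (hF : Monotone F) {G : Set α} (hG : G.Finite)
    (hFG : ∀ Y, F Y ⊆ G) {r : ℕ} (hr : G.ncard ≤ r) : F^[r] G = FixKind.nu.fixpoint F := by
  have hsub : ∀ i, F^[i] G ⊆ G := by
    intro i
    cases i with
    | zero => simp
    | succ i => rw [Function.iterate_succ_apply']; exact hFG _
  have hmono : ∀ i, F^[i + 1] G ⊆ F^[i] G := by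
    intro i
    induction i with
    | zero => exact hFG _
    | succ i ih =>
      simpa only [← Function.iterate_succ_apply' F] using hF ih
  have hfix : F^[r + 1] G = F^[r] G := by
    by_contra he
    have hlt : ∀ j, j ≤ r → F^[j + 1] G ⊂ F^[j] G := by
      intro j hj
      refine (hmono j).ssubset_of_ne fun h => he ?_
      obtain ⟨d, rfl⟩ := Nat.exists_eq_add_of_le hj
      have : ∀ d, F^[j + d + 1] G = F^[j + d] G := by
        intro d
        induction d with
        | zero => exact h
        | succ d ih =>
          rw [Function.iterate_succ_apply', ← add_assoc, ih, ← Function.iterate_succ_apply' F]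
          exact ih
      exact this d
    have : ∀ j, j ≤ r → (F^[j + 1] G).ncard + (j + 1) ≤ G.ncard := by
      intro j
      induction j with
      | zero =>
        intro hj
        have := Set.ncard_lt_ncard (hlt 0 hj) (hG.subset (hsub _))
        simpa using this
      | succ j ih =>
        intro hj
        have := Set.ncard_lt_ncard (hlt (j + 1) hj) (hG.subset (hsub _))
        have := ih (by omega)
        omega
    have := this r le_rfl
    omega
  rw [Function.iterate_succ_apply'] at hfix
  refine Set.Subset.antisymm (Set.subset_sUnion_of_mem hfix.ge) (Set.sUnion_subset fun Y hY => ?_)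
  have : ∀ i, Y ⊆ F^[i] G := by
    intro i
    induction i with
    | zero => exact hY.trans (hFG Y)
    | succ i ih =>
      rw [Function.iterate_succ_apply']
      exact hY.trans (hF ih)
  exact this r

theorem FixKind.fixpoint_mono (η : FixKind) {F F' : Set α → Set α} (h : ∀ Y, F Y ⊆ F' Y) :
    η.fixpoint F ⊆ η.fixpoint F' := by
  cases η with
  | mu => exact Set.sInter_subset_sInter fun Y hY => (h Y).trans hY
  | nu => exact Set.sUnion_subset_sUnion fun Y hY => hY.trans (h Y)

theorem FixKind.fixpoint_subset (η : FixKind) {F : Set α → Set α} {G : Set α}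
    (h : ∀ Y, F Y ⊆ G) : η.fixpoint F ⊆ G := by
  cases η with
  | mu => exact Set.sInter_subset_of_mem (h G)
  | nu => exact Set.sUnion_subset fun Y hY => hY.trans (h Y)

theorem nestedFixpoint_mono (η : ℕ → FixKind) {F : (ℕ → Set α) → Set α} (hF : Monotone F) (i : ℕ) :
    Monotone (nestedFixpoint η F i) := by
  induction i with
  | zero => exact hF
  | succ i ih =>
    intro X X' h
    refine FixKind.fixpoint_mono _ fun Y => ih fun j => ?_
    by_cases hj : j = i + 1
    · subst hj; simp
    · simpa [hj] using h j

theorem nestedFixpoint_subset (η : ℕ → FixKind) {F : (ℕ → Set α) → Set α} {G : Set α}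
    (hF : ∀ X, F X ⊆ G) (i : ℕ) (X : ℕ → Set α) : nestedFixpoint η F i X ⊆ G := by
  induction i generalizing X with
  | zero => exact hF X
  | succ i ih => exact FixKind.fixpoint_subset _ fun Y => ih _

/-- The inner fixpoint is a monotone function of the next variable with values in `G`, so the two
lemmas on iteration apply at each level. Passing from lists to the sets of their members commutes
with each round. -/
theorem computeFixpoint_val (w : ℕ) (η : ℕ → FixKind) (F : (ℕ → List α) → Timed (List α))
    (F' : (ℕ → Set α) → Set α) (G : List α) (hF' : Monotone F') (hG : ∀ X, F' X ⊆ {v | v ∈ G})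
    (hF : ∀ X, {v | v ∈ (F X).val} = F' fun i => {v | v ∈ X i}) (i : ℕ) (X : ℕ → List α) :
    {v | v ∈ (computeFixpoint w η F G i X).val} = nestedFixpoint η F' i fun i => {v | v ∈ X i} := by
  induction i generalizing X with
  | zero => exact hF X
  | succ i ih =>
    set Φ : Set α → Set α := fun Y =>
      nestedFixpoint η F' i (Function.update (fun i => {v | v ∈ X i}) (i + 1) Y) with hΦ
    have hmono : Monotone Φ := fun Y Y' h =>
      nestedFixpoint_mono η hF' i (update_le_update_iff'.2 h)
    have hsub : ∀ Y, Φ Y ⊆ {v | v ∈ G} := fun Y => nestedFixpoint_subset η hG i _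
    have hfin : {v | v ∈ G}.Finite := List.finite_toSet G
    have hcard : {v | v ∈ G}.ncard ≤ G.length := by
      have : {v | v ∈ G} = (G.toFinset : Set α) := by ext; simp
      rw [this, Set.ncard_coe_finset]
      exact List.toFinset_card_le G
    have hiter : ∀ r Y, {v | v ∈ (fun Y => (computeFixpoint w η F G i
        (Function.update X (i + 1) Y)).val)^[r] Y} = Φ^[r] {v | v ∈ Y} := by
      intro r
      induction r with
      | zero => intro Y; rfl
      | succ r ihr =>
        intro Y
        rw [Function.iterate_succ_apply, Function.iterate_succ_apply, ihr, ih]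
        congr 2
        funext j
        by_cases hj : j = i + 1
        · subst hj; simp
        · simp [hj]
    simp only [computeFixpoint, nestedFixpoint, Timed.iterate_val]
    rw [hiter]
    cases η (i + 1) with
    | mu =>
      rw [← iterate_empty_eq_lfp hmono hfin hsub hcard]
      simp
    | nu => rw [← iterate_eq_gfp hmono hfin hsub hcard]

/-- Inner iterations restart in every outer round, so a level costs at most `R` times the level
below plus overhead `w` per round; the bound solves this recursion. Lengths are tracked since the
cost of `F` depends on those of its arguments. -/
theorem computeFixpoint_le (w : ℕ) (η : ℕ → FixKind) (F : (ℕ → List α) → Timed (List α))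
    (G : List α) (R c : ℕ) (hR : 1 ≤ R) (hG : G.length ≤ R)
    (hF : ∀ X : ℕ → List α, (∀ i, (X i).length ≤ R) →
      (F X).val.length ≤ R ∧ (F X).time ≤ c)
    (i : ℕ) (X : ℕ → List α) (hX : ∀ i, (X i).length ≤ R) :
    (computeFixpoint w η F G i X).val.length ≤ R ∧
      (computeFixpoint w η F G i X).time ≤ R ^ i * (c + i * w) := by
  induction i generalizing X with
  | zero => simpa [computeFixpoint] using hF X hX
  | succ i ih =>
    have h := Timed.iterate_le w
      (f := fun Y => computeFixpoint w η F G i (Function.update X (i + 1) Y))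
      (fun Y => Y.length ≤ R) (R ^ i * (c + i * w)) G.length (fun Y hY => ih _ fun j => by
        by_cases hj : j = i + 1
        · subst hj; simpa using hY
        · simpa [hj] using hX j)
      (match η (i + 1) with
        | .mu => []
        | .nu => G) (by cases η (i + 1) <;> simp [hG])
    refine ⟨h.1, h.2.trans ?_⟩
    calc G.length * (w + R ^ i * (c + i * w))
        ≤ R * (R ^ i * w + R ^ i * (c + i * w)) := by
          refine Nat.mul_le_mul hG (Nat.add_le_add_right ?_ _)
          exact Nat.le_mul_of_pos_left w (Nat.pow_pos hR)
      _ = _ := by ring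

end Fixpoints

/-! ### Transport of one-step satisfiability -/

section OneStep

variable {T : Type u → Type u} [Functor T] {Λ : Type u} (L : CoalgebraicLogic T Λ)

/-- If `φ` matches the truth sets of corresponding variables, naturality of the liftings makes `φ
<$> τ` a witness whenever `τ` is one. Neither injectivity nor surjectivity of `φ` is needed. -/
theorem CoalgebraicLogic.OneStepSat.map {V W : Type u} {v : Finset (Λ × V)} {v' : Finset (Λ × W)}
    {U : Set (Finset V)} {U' : Set (Finset W)} (h : L.OneStepSat v U) (φ : U → U')
    (hv : ∀ y ∈ v', ∃ x ∈ v, x.1 = y.1 ∧ ∀ a : U, x.2 ∈ a.1 ↔ y.2 ∈ (φ a).1) :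
    L.OneStepSat v' U' := by
  obtain ⟨τ, hτ⟩ := h
  refine ⟨φ <$> τ, fun y hy => ?_⟩
  obtain ⟨x, hx, hxy, hφ⟩ := hv y hy
  have h1 := hτ x hx
  have h2 : {a : U | x.2 ∈ a.1} = φ ⁻¹' {b : U' | y.2 ∈ b.1} := by ext a; exact hφ a
  rw [h2, hxy, L.natural] at h1
  exact h1

theorem CoalgebraicLogic.oneStepSat_mono {V : Type u} (v : Finset (Λ × V)) {U U' : Set (Finset V)}
    (hU : U ⊆ U') (h : L.OneStepSat v U) : L.OneStepSat v U' :=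
  h.map L (Set.inclusion hU) fun y hy => ⟨y, hy, rfl, fun _ => Iff.rfl⟩

end OneStep

theorem length_propLetters_le {Λ : Type u} (ψ : Formula Λ) : (propLetters ψ).length ≤ 2 := by
  cases ψ <;> simp [propLetters]

namespace Setting

variable {T : Type u → Type u} [Functor T] {Λ : Type u} {L : CoalgebraicLogic T Λ} (P : Setting L)

/-! ### The size parameters -/

theorem one_le_n : 1 ≤ P.n := Formula.one_le_size _ L.size_pos _

theorem one_le_k : 1 ≤ P.k := le_max_left _ _

theorem card_FL_le : P.target.FL.card ≤ P.n := P.target.card_FL_le _ L.size_pos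

/-! ### Reachable nodes -/

/-- The small Safra trees over the closure; they include all reachable nodes. -/
noncomputable def nodes : Finset (Node Λ) := SafraTree.smallTrees P.target.FL P.k

theorem card_nodes_le : P.nodes.card ≤ (P.n * P.k + 4) ^ (P.n * P.k + 1) :=
  SafraTree.card_smallTrees_le _ _ _ P.one_le_k P.card_FL_le

/-- Nodes that satisfy the invariant of the Safra construction. -/
def IsNode (v : Node Λ) : Prop := SafraTree.IsSmall P.target.FL P.k v

theorem isNode_v0 : P.IsNode P.v0 :=
  SafraTree.isSmall_initial _ P.target.formula_mem_FL

variable {P} in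
theorem IsNode.delta {v : Node Λ} (h : P.IsNode v) (a : Letter Λ) : P.IsNode (P.delta v a) :=
  SafraTree.IsSmall.step _ h (Nat.mul_le_mul P.card_FL_le (Nat.div_le_self _ _)) a
    fun _ hq _ ht => P.target.mem_FL_of_tracks hq ht

variable {P} in
theorem length_le_of_isNode {l : List (Node Λ)} (hl : l.Nodup) (h : ∀ v ∈ l, P.IsNode v) :
    l.length ≤ P.nodes.card := by
  rw [← List.toFinset_card_of_nodup hl]
  exact Finset.card_le_card fun v hv => (h v (List.mem_toFinset.1 hv)).mem_smallTrees

theorem one_le_card_nodes : 1 ≤ P.nodes.card :=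
  Finset.card_pos.2 ⟨_, P.isNode_v0.mem_smallTrees⟩

theorem two_le_two_pow_n : 2 ≤ 2 ^ P.n := by
  simpa using Nat.pow_le_pow_right (n := 2) (by norm_num) P.one_le_n

theorem length_selectionLetters_le : P.selectionLetters.length ≤ 2 ^ P.n := by
  simp only [selectionLetters, List.length_map, Finset.length_toList, Target.selections,
    Finset.card_powerset]
  exact Nat.pow_le_pow_right (by norm_num) ((Finset.card_filter_le _ _).trans P.card_FL_le)

theorem length_expansionLetters_le (v : Node Λ) : (P.expansionLetters v).length ≤ 2 ^ P.n := by
  unfold expansionLetters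
  split_ifs
  · exact P.length_selectionLetters_le
  · exact (length_propLetters_le _).trans P.two_le_two_pow_n

/-! ### Correctness of the iteration -/

theorem mem_literals (v : Node Λ) (x : Λ × Formula Λ) :
    x ∈ P.literals v ↔ Formula.modal x.1 x.2 ∈ P.target.label v := by
  simp only [literals, Finset.mem_biUnion]
  constructor
  · rintro ⟨ψ, hψ, hx⟩
    cases ψ <;> simp at hx
    subst hx; exact hψ
  · intro h
    exact ⟨_, h, by simp⟩

/-- The literals of a node, each with itself as variable. -/
noncomputable def instanceLiterals (v : Node Λ) : Finset (Λ × Formula Λ) :=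
  (P.literals v).image fun x => (x.1, .modal x.1 x.2)

/-- The part of the label of `v` that holds at a successor with label `y`. -/
noncomputable def restrict (v : Node Λ) (y : Finset (Formula Λ)) : Finset (Formula Λ) :=
  (P.target.label v).filter fun θ => ∃ h ψ, θ = Formula.modal h ψ ∧ ψ ∈ y

theorem modal_mem_restrict {v : Node Λ} {y : Finset (Formula Λ)} {x : Λ × Formula Λ}
    (hx : x ∈ P.literals v) : Formula.modal x.1 x.2 ∈ P.restrict v y ↔ x.2 ∈ y := by
  simp only [restrict, Finset.mem_filter, (P.mem_literals v x).1 hx, true_and]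
  constructor
  · rintro ⟨h, ψ, e, hψ⟩
    injection e with _ e
    exact e ▸ hψ
  · exact fun h => ⟨_, _, rfl, h⟩

/-- The variable is the whole literal `♥ψ`, so it also determines `♥`; with `ψ` as variable, `♥₁ψ`
and `♥₂ψ` would clash. -/
theorem isOneStepInput_instanceLiterals (v : Node Λ) :
    IsOneStepInput (P.instanceLiterals v) := by
  intro x hx y hy h
  simp only [instanceLiterals, Finset.coe_image, Set.mem_image] at hx hy
  obtain ⟨x, -, rfl⟩ := hx
  obtain ⟨y, -, rfl⟩ := hy
  simp only [Formula.modal.injEq] at h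
  simp [h.1, h.2]

/-- Both directions transport a witness: restriction maps `Y` onto its image, and any choice of
preimages maps back while preserving the truth of the literals of `v`. -/
theorem oneStepSat_restrict_iff (v : Node Λ) (Y : Set (Finset (Formula Λ))) :
    L.OneStepSat (P.instanceLiterals v) (P.restrict v '' Y) ↔ L.OneStepSat (P.literals v) Y := by
  constructor
  · intro h
    refine h.map L (fun l => ⟨l.2.choose, l.2.choose_spec.1⟩) fun y hy =>
      ⟨_, Finset.mem_image_of_mem _ hy, rfl, fun l => ?_⟩
    rw [← P.modal_mem_restrict hy, l.2.choose_spec.2]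
  · intro h
    refine h.map L (fun y => ⟨P.restrict v y, Set.mem_image_of_mem _ y.2⟩) fun x hx => ?_
    obtain ⟨y, hy, rfl⟩ := Finset.mem_image.1 hx
    exact ⟨y, hy, rfl, fun a => (P.modal_mem_restrict hy).symm⟩

theorem checkState_val (v : Node Λ) (as : List (Letter Λ)) :
    (P.checkState v as).val = true ↔
      L.OneStepSat (P.literals v) {y | ∃ a ∈ as, y = P.target.label (P.delta v a)} := by
  rw [← P.oneStepSat_restrict_iff]
  unfold checkState
  simp only [Timed.bind, Timed.charge, Timed.pure]
  refine (P.solver.correct _ _ (P.isOneStepInput_instanceLiterals v)).trans (iff_of_eq ?_)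
  congr 1
  ext l
  simp only [List.coe_toFinset, Set.mem_ofPred_eq, Timed.mem_image_val, Set.mem_image]
  constructor
  · rintro ⟨a, ha, rfl⟩
    exact ⟨_, ⟨a, ha, rfl⟩, rfl⟩
  · rintro ⟨_, ⟨a, ha, rfl⟩, rfl⟩
    exact ⟨a, ha, rfl⟩

theorem checkEdge_val (X : ℕ → List (Node Λ)) (v : Node Λ) (a : Letter Λ) :
    (P.checkEdge X v a).val = true ↔ P.delta v a ∈ X (P.beta v a) := by
  simp [checkEdge, Timed.charge, Timed.mem_val]

theorem checkF_val (X : ℕ → List (Node Λ)) (G : List (Node Λ)) (v : Node Λ) :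
    v ∈ G ∧ (P.checkF X v).val = true ↔ v ∈ P.f {v | v ∈ G} fun i => {v | v ∈ X i} := by
  by_cases hs : P.target.IsState v
  · have : (P.checkF X v).val = true ↔
        L.OneStepSat (P.literals v) (P.successorLabels (fun i => {v | v ∈ X i}) v) := by
      simp only [checkF, Timed.charge, if_pos hs, Timed.bind, checkState_val]
      refine iff_of_eq ?_
      congr 1
      ext y
      simp [successorLabels, Timed.filter_val, selectionLetters, checkEdge_val, and_assoc]
    simp [f, hs, this]
  · simp [f, hs, checkF, Timed.charge, Timed.any_val, checkEdge_val]

theorem checkG_val (X : ℕ → List (Node Λ)) (G : List (Node Λ)) (v : Node Λ) :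
    v ∈ G ∧ (P.checkG X v).val = true ↔ v ∈ P.g {v | v ∈ G} fun i => {v | v ∈ X i} := by
  by_cases hs : P.target.IsState v
  · have : (P.checkG X v).val = true ↔
        ¬ L.OneStepSat (P.literals v) (P.successorLabels (fun i => {v | v ∈ X i}ᶜ) v) := by
      simp only [checkG, Timed.charge, if_pos hs, Timed.bind, Timed.pure, Bool.not_eq_true',
        ← Bool.not_eq_true, checkState_val]
      refine not_congr (iff_of_eq ?_)
      congr 1
      ext y
      simp [successorLabels, Timed.filter_val, selectionLetters, ← checkEdge_val, and_assoc]
    simp [g, hs, this]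
  · simp [g, hs, checkG, Timed.charge, Timed.all_val, checkEdge_val]

theorem successorLabels_mono (v : Node Λ) {X Y : ℕ → Set (Node Λ)} (h : X ≤ Y) :
    P.successorLabels X v ⊆ P.successorLabels Y v :=
  fun _ ⟨σ, hσ, hX, hy⟩ => ⟨σ, hσ, h _ hX, hy⟩

theorem monotone_f (G : Set (Node Λ)) : Monotone (P.f G) := by
  rintro X Y h v (⟨hv, hs, a, ha, hX⟩ | ⟨hv, hs, hX⟩)
  · exact Or.inl ⟨hv, hs, a, ha, h _ hX⟩
  · exact Or.inr ⟨hv, hs, L.oneStepSat_mono _ (P.successorLabels_mono v h) hX⟩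

/-- For states the argument is complemented and satisfiability negated; the two reversals cancel. -/
theorem monotone_g (G : Set (Node Λ)) : Monotone (P.g G) := by
  rintro X Y h v (⟨hv, hs, hX⟩ | ⟨hv, hs, hX⟩)
  · exact Or.inl ⟨hv, hs, fun a ha => h _ (hX a ha)⟩
  · exact Or.inr ⟨hv, hs, fun hY => hX (L.oneStepSat_mono _
      (P.successorLabels_mono v fun i => Set.compl_subset_compl.2 (h i)) hY)⟩

theorem f_subset (G : Set (Node Λ)) (X : ℕ → Set (Node Λ)) : P.f G X ⊆ G := by
  rintro v (⟨hv, -⟩ | ⟨hv, -⟩) <;> exact hv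

theorem g_subset (G : Set (Node Λ)) (X : ℕ → Set (Node Λ)) : P.g G X ⊆ G := by
  rintro v (⟨hv, -⟩ | ⟨hv, -⟩) <;> exact hv

theorem computeE_val (G : List (Node Λ)) : {v | v ∈ (P.computeE G).val} = P.E {v | v ∈ G} := by
  refine (computeFixpoint_val P.opCost etaKind _ _ G (P.monotone_f _) (P.f_subset _)
    (fun X => ?_) _ _).trans (by simp [E])
  ext v
  rw [← checkF_val, Timed.filter_val]
  exact List.mem_filter

theorem computeA_val (G : List (Node Λ)) : {v | v ∈ (P.computeA G).val} = P.A {v | v ∈ G} := by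
  refine (computeFixpoint_val P.opCost etaKindDual _ _ G (P.monotone_g _) (P.g_subset _)
    (fun X => ?_) _ _).trans (by simp [A])
  ext v
  rw [← checkG_val, Timed.filter_val]
  exact List.mem_filter

/-! ### Running time of the iteration -/

/-- The variables of the instance are distinct literals of the closure, whose head sizes sum to at
most `n`. -/
theorem inputSize_instanceLiterals_le (v : Node Λ) :
    L.inputSize (P.instanceLiterals v) ≤ P.n := by
  have h : ∀ x ∈ P.instanceLiterals v, x.2 ∈ P.target.FL ∧ L.size x.1 = x.2.headSize L.size := by
    intro x hx
    obtain ⟨y, hy, rfl⟩ := Finset.mem_image.1 hx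
    exact ⟨(Finset.mem_filter.1 ((P.mem_literals v y).1 hy)).1, rfl⟩
  calc L.inputSize (P.instanceLiterals v)
      = ∑ x ∈ P.instanceLiterals v, x.2.headSize L.size := Finset.sum_congr rfl fun x hx => (h x hx).2
    _ = ∑ θ ∈ (P.instanceLiterals v).image Prod.snd, θ.headSize L.size :=
        (Finset.sum_image (P.isOneStepInput_instanceLiterals v)).symm
    _ ≤ ∑ θ ∈ P.target.FL, θ.headSize L.size :=
        Finset.sum_le_sum_of_subset fun θ hθ => by
          obtain ⟨x, hx, rfl⟩ := Finset.mem_image.1 hθ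
          exact (h x hx).1
    _ ≤ P.n := P.target.sum_headSize_FL_le _

theorem checkState_time_le {t : ℕ → ℕ → ℕ} (ht : P.solver.RunsIn t) (v : Node Λ)
    (as : List (Letter Λ)) :
    (P.checkState v as).time ≤
      as.length * ((as.length + 1) * P.opCost) + t P.n (2 ^ P.n) := by
  unfold checkState
  simp only [Timed.bind, Timed.charge, Timed.pure, add_zero]
  refine Nat.add_le_add (Timed.image_time_le _ _ _) (ht _ _
    (P.isOneStepInput_instanceLiterals v) _ _ (P.inputSize_instanceLiterals_le v) ?_)
  -- The restricted labels are subsets of the closure, so their number is bounded independently of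
  -- the number of nodes.
  calc _ ≤ P.target.FL.powerset.card := Finset.card_le_card fun y hy => by
        rw [List.mem_toFinset, Timed.mem_image_val] at hy
        obtain ⟨a, -, rfl⟩ := hy
        exact Finset.mem_powerset.2
          ((Finset.filter_subset _ _).trans (Finset.filter_subset _ _))
    _ ≤ 2 ^ P.n := by
        rw [Finset.card_powerset]
        exact Nat.pow_le_pow_right (by norm_num) P.card_FL_le

theorem checkEdge_time_le (X : ℕ → List (Node Λ)) (R : ℕ) (hX : ∀ i, (X i).length ≤ R)
    (v : Node Λ) (a : Letter Λ) : (P.checkEdge X v a).time ≤ P.opCost + R * P.opCost :=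
  Nat.add_le_add_left ((Timed.mem_time_le _ _ _).trans (Nat.mul_le_mul_right _ (hX _))) _

/-- Bound for the time of one evaluation of `f` or `g` at a node, for sets with at most `R`
elements. -/
def checkCost (t : ℕ → ℕ → ℕ) (R : ℕ) : ℕ :=
  P.opCost + (2 ^ P.n * (P.opCost + R * P.opCost) +
    (2 ^ P.n * ((2 ^ P.n + 1) * P.opCost) + t P.n (2 ^ P.n)))

theorem checkState_filter_time_le {t : ℕ → ℕ → ℕ} (ht : P.solver.RunsIn t)
    (p : Letter Λ → Timed Bool) (v : Node Λ) :
    (P.checkState v (Timed.filter p P.selectionLetters).val).time ≤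
      2 ^ P.n * ((2 ^ P.n + 1) * P.opCost) + t P.n (2 ^ P.n) := by
  have hl : (Timed.filter p P.selectionLetters).val.length ≤ 2 ^ P.n := by
    rw [Timed.filter_val]
    exact (List.length_filter_le _ _).trans P.length_selectionLetters_le
  refine (P.checkState_time_le ht v _).trans ?_
  gcongr

theorem checkF_time_le {t : ℕ → ℕ → ℕ} (ht : P.solver.RunsIn t)
    (X : ℕ → List (Node Λ)) (R : ℕ) (hX : ∀ i, (X i).length ≤ R)
    (v : Node Λ) : (P.checkF X v).time ≤ P.checkCost t R := by
  refine Nat.add_le_add_left ?_ _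
  split_ifs
  · refine Nat.add_le_add ((Timed.filter_time_le _ _ _ fun a _ =>
      P.checkEdge_time_le X R hX v a).trans ?_) (P.checkState_filter_time_le ht _ _)
    exact Nat.mul_le_mul_right _ P.length_selectionLetters_le
  · refine (Timed.any_time_le _ _ _ fun a _ => P.checkEdge_time_le X R hX v a).trans ?_
    exact (Nat.mul_le_mul_right _ ((length_propLetters_le _).trans P.two_le_two_pow_n)).trans
      (Nat.le_add_right _ _)

theorem checkG_time_le {t : ℕ → ℕ → ℕ} (ht : P.solver.RunsIn t)
    (X : ℕ → List (Node Λ)) (R : ℕ) (hX : ∀ i, (X i).length ≤ R)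
    (v : Node Λ) : (P.checkG X v).time ≤ P.checkCost t R := by
  refine Nat.add_le_add_left ?_ _
  split_ifs
  · refine Nat.add_le_add ((Timed.filter_time_le _ _ _ fun a _ =>
      show ((P.checkEdge X v a).bind fun b => .pure (!b)).time ≤ _ from
        P.checkEdge_time_le X R hX v a).trans ?_) (P.checkState_filter_time_le ht _ _)
    exact Nat.mul_le_mul_right _ P.length_selectionLetters_le
  · refine (Timed.all_time_le _ _ _ fun a _ => P.checkEdge_time_le X R hX v a).trans ?_
    exact (Nat.mul_le_mul_right _ ((length_propLetters_le _).trans P.two_le_two_pow_n)).trans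
      (Nat.le_add_right _ _)

/-- Bound for the time of one computation of `E_G` or `A_G`, for sets with at most `R` elements. -/
def fixpointCost (t : ℕ → ℕ → ℕ) (R : ℕ) : ℕ :=
  R ^ (2 * P.n * P.k) * (R * P.checkCost t R + 2 * P.n * P.k * P.opCost)

theorem computeE_le {t : ℕ → ℕ → ℕ} (ht : P.solver.RunsIn t)
    (G : List (Node Λ)) (R : ℕ) (hR : 1 ≤ R) (hG : G.length ≤ R) :
    (P.computeE G).val.length ≤ R ∧ (P.computeE G).time ≤ P.fixpointCost t R := by
  refine computeFixpoint_le _ _ _ G R _ hR hG (fun X hX => ⟨?_, ?_⟩) _ _ (by simp)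
  · rw [Timed.filter_val]
    exact (List.length_filter_le _ _).trans hG
  · exact (Timed.filter_time_le _ _ _ fun v _ => P.checkF_time_le ht X R hX v).trans
      (Nat.mul_le_mul_right _ hG)

theorem computeA_le {t : ℕ → ℕ → ℕ} (ht : P.solver.RunsIn t)
    (G : List (Node Λ)) (R : ℕ) (hR : 1 ≤ R) (hG : G.length ≤ R) :
    (P.computeA G).val.length ≤ R ∧ (P.computeA G).time ≤ P.fixpointCost t R := by
  refine computeFixpoint_le _ _ _ G R _ hR hG (fun X hX => ⟨?_, ?_⟩) _ _ (by simp)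
  · rw [Timed.filter_val]
    exact (List.length_filter_le _ _).trans hG
  · exact (Timed.filter_time_le _ _ _ fun v _ => P.checkG_time_le ht X R hX v).trans
      (Nat.mul_le_mul_right _ hG)

/-! ### Runs -/

/-- The lists of unexpanded and expanded nodes are disjoint duplicate-free lists of nodes. -/
def IsPartition (U G : List (Node Λ)) : Prop := (U ++ G).Nodup ∧ ∀ v ∈ U ++ G, P.IsNode v

variable {P} in
theorem IsPartition.length_le {U G : List (Node Λ)} (h : P.IsPartition U G) :
    U.length + G.length ≤ P.nodes.card := by
  rw [← List.length_append]
  exact length_le_of_isNode h.1 h.2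

/-- The invariant of the algorithm. -/
def Config.Valid : Config Λ → Prop
  | .start => True
  | .expansion U G => U ≠ [] ∧ P.IsPartition U G
  | .propagation U G => G ≠ [] ∧ P.IsPartition U G
  | .final G => P.IsPartition [] G
  | .halt _ => True

/-- Bound for the time of one expansion step, for at most `R` nodes. -/
def expandCost (R : ℕ) : ℕ :=
  P.opCost + (R * P.opCost + 2 ^ P.n * (P.opCost + (R * P.opCost + (R + 1) * P.opCost)))

/-- A successor is inserted only if it is in neither list, so the lists stay disjoint and
duplicate-free and together never exceed the number of nodes. That also bounds every list search in
the loop. -/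
theorem expand_spec {u : Node Λ} {U G : List (Node Λ)} (hu : u ∈ U) (h : P.IsPartition U G) :
    (∃ U', (P.expand u U G).val = .propagation U' (u :: G) ∧ P.IsPartition U' (u :: G)) ∧
      (P.expand u U G).time ≤ P.expandCost P.nodes.card := by
  have hU₁ : P.IsPartition (U.filter fun x => decide (x ≠ u)) (u :: G) := by
    obtain ⟨h1, h2⟩ := h
    rw [List.nodup_append] at h1
    constructor
    · rw [List.nodup_append, List.nodup_cons]
      refine ⟨h1.1.filter _, ⟨fun hG => h1.2.2 u hu u hG rfl, h1.2.1⟩, ?_⟩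
      intro a ha b hb
      rw [List.mem_filter] at ha
      rcases List.mem_cons.1 hb with rfl | hb
      · simpa using ha.2
      · exact h1.2.2 a ha.1 b hb
    · intro v hv
      simp only [List.mem_append, List.mem_filter, List.mem_cons] at hv h2
      rcases hv with hv | rfl | hv
      exacts [h2 v (Or.inl hv.1), h2 _ (Or.inl hu), h2 v (Or.inr hv)]
  have hu' : P.IsNode u := h.2 u (by simp [hu])
  have hfold := Timed.fold_le
    (f := fun a U₂ => .charge P.opCost <|
      (Timed.mem P.opCost (P.delta u a) (u :: G)).bind fun b =>
        if b then .pure U₂ else Timed.insert P.opCost (P.delta u a) U₂)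
    (fun U₂ => P.IsPartition U₂ (u :: G))
    (P.opCost + (P.nodes.card * P.opCost + (P.nodes.card + 1) * P.opCost))
    (P.expansionLetters u) (fun a _ U₂ hU₂ => by
      have hl := hU₂.length_le
      have hm := (Timed.mem_time_le P.opCost (P.delta u a) (u :: G)).trans
        (Nat.mul_le_mul_right P.opCost (show (u :: G).length ≤ P.nodes.card by omega))
      have hi := (Timed.insert_time_le P.opCost (P.delta u a) U₂).trans
        (Nat.mul_le_mul_right P.opCost (show U₂.length + 1 ≤ P.nodes.card + 1 by omega))
      cases hb : (Timed.mem P.opCost (P.delta u a) (u :: G)).val with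
      | true =>
        refine ⟨by simpa [Timed.charge, Timed.bind, hb, Timed.pure] using hU₂, ?_⟩
        simp [Timed.charge, Timed.bind, hb, Timed.pure]; omega
      | false =>
        constructor
        · simp only [Timed.charge, Timed.bind, hb, Bool.false_eq_true, if_false, Timed.insert_val]
          split_ifs with hmem
          · exact hU₂
          · have hnm : P.delta u a ∉ u :: G := by
              rw [← Timed.mem_val P.opCost, hb]; simp
            refine ⟨?_, ?_⟩
            · rw [List.cons_append, List.nodup_cons, List.mem_append]
              exact ⟨fun h => h.elim hmem hnm, hU₂.1⟩
            · intro v hv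
              rcases List.mem_cons.1 hv with rfl | hv
              exacts [hu'.delta a, hU₂.2 v hv]
        · simp [Timed.charge, Timed.bind, hb]; omega)
    _ hU₁
  have hUl := h.length_le
  have hfil := (Timed.filter_time_le
    (fun x => .charge P.opCost (.pure (decide (x ≠ u)))) U P.opCost
      (fun x _ => by simp [Timed.charge, Timed.pure])).trans
    (Nat.mul_le_mul_right P.opCost (show U.length ≤ P.nodes.card by omega))
  have e : (Timed.filter (fun x => .charge P.opCost (.pure (decide (x ≠ u)))) U).val =
      U.filter fun x => decide (x ≠ u) := Timed.filter_val _ _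
  constructor
  · refine ⟨_, rfl, ?_⟩
    rw [← e] at hfold
    exact hfold.1
  · have h2 := hfold.2.trans (Nat.mul_le_mul_right _ (P.length_expansionLetters_le u))
    rw [← e] at h2
    simp only [expand, Timed.charge, Timed.bind, Timed.pure, expandCost, add_zero] at h2 hfil ⊢
    omega

/-- Bound for the time of one propagation step, for at most `R` nodes. -/
def propagateCost (t : ℕ → ℕ → ℕ) (R : ℕ) : ℕ :=
  2 * (P.fixpointCost t R + R * P.opCost) + P.opCost

variable {P} in
theorem computeE_mem_time_le {t : ℕ → ℕ → ℕ} (ht : P.solver.RunsIn t) {G : List (Node Λ)}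
    (hG : G.length ≤ P.nodes.card) (v : Node Λ) :
    (P.computeE G).time + (Timed.mem P.opCost v (P.computeE G).val).time ≤
      P.fixpointCost t P.nodes.card + P.nodes.card * P.opCost := by
  have h := P.computeE_le ht G _ P.one_le_card_nodes hG
  exact Nat.add_le_add h.2 ((Timed.mem_time_le _ _ _).trans (Nat.mul_le_mul_right _ h.1))

variable {P} in
theorem computeA_mem_time_le {t : ℕ → ℕ → ℕ} (ht : P.solver.RunsIn t) {G : List (Node Λ)}
    (hG : G.length ≤ P.nodes.card) (v : Node Λ) :
    (P.computeA G).time + (Timed.mem P.opCost v (P.computeA G).val).time ≤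
      P.fixpointCost t P.nodes.card + P.nodes.card * P.opCost := by
  have h := P.computeA_le ht G _ P.one_le_card_nodes hG
  exact Nat.add_le_add h.2 ((Timed.mem_time_le _ _ _).trans (Nat.mul_le_mul_right _ h.1))

theorem propagateA_val (doA : Bool) (U G : List (Node Λ)) :
    (P.propagateA doA U G).val = .halt false ∨ (P.propagateA doA U G).val = proceed U G := by
  unfold propagateA
  cases doA
  · exact Or.inr rfl
  · simp only [Timed.charge, Timed.bind, Timed.pure, if_true]
    split_ifs <;> simp

theorem propagate_val (doE doA : Bool) (U G : List (Node Λ)) :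
    (∃ b, (P.propagate doE doA U G).val = .halt b) ∨
      (P.propagate doE doA U G).val = proceed U G := by
  have hA := (P.propagateA_val doA U G).imp_left fun h => (⟨false, h⟩ : ∃ b, _ = Config.halt b)
  unfold propagate
  cases doE
  · simpa using hA
  · simp only [Timed.bind, if_true]
    split_ifs
    · exact Or.inl ⟨true, rfl⟩
    · exact hA

theorem propagate_time_le {t : ℕ → ℕ → ℕ} (ht : P.solver.RunsIn t) (doE doA : Bool)
    {U G : List (Node Λ)} (hG : G.length ≤ P.nodes.card) :
    (P.propagate doE doA U G).time ≤ P.propagateCost t P.nodes.card := by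
  have hA : (P.propagateA doA U G).time ≤
      P.fixpointCost t P.nodes.card + P.nodes.card * P.opCost + P.opCost := by
    have := computeA_mem_time_le ht hG P.v0
    cases doA
    · simp [propagateA, Timed.charge, Timed.pure]
    · simp [propagateA, Timed.charge, Timed.bind, Timed.pure]; omega
  have hE := computeE_mem_time_le ht hG P.v0
  unfold propagateCost propagate
  cases doE
  · simp; omega
  · simp only [Timed.bind, if_true]
    split_ifs
    · simp only [Timed.pure]; omega
    · omega

theorem finish_time_le {t : ℕ → ℕ → ℕ} (ht : P.solver.RunsIn t)
    {G : List (Node Λ)} (hG : G.length ≤ P.nodes.card) :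
    (P.finish G).time ≤ P.propagateCost t P.nodes.card := by
  have hE := computeE_mem_time_le ht hG P.v0
  simp only [finish, propagateCost, Timed.bind, Timed.pure]
  omega

variable {P} in
theorem valid_proceed {U G : List (Node Λ)} (h : P.IsPartition U G) :
    Config.Valid P (proceed U G) := by
  cases U with
  | nil => exact h
  | cons u U => exact ⟨by simp, h⟩

theorem valid_step {c c' : Config Λ} {s : ℕ} (h : Config.Valid P c) (hs : P.Step c s c') :
    Config.Valid P c' := by
  cases hs with
  | start =>
    exact ⟨by simp, by simp, by simpa using P.isNode_v0⟩
  | expansion u U G hu =>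
    obtain ⟨⟨U', e, h'⟩, -⟩ := P.expand_spec hu h.2
    rw [e]; exact ⟨by simp, h'⟩
  | propagation doE doA U G =>
    rcases P.propagate_val doE doA U G with ⟨b, e⟩ | e
    · rw [e]; trivial
    · rw [e]; exact valid_proceed h.2
  | final G => trivial

theorem valid_run {s : ℕ} {c : Config Λ} (h : P.Run s c) : Config.Valid P c := by
  induction h with
  | nil => trivial
  | cons _ _ _ _ _ hs ih => exact P.valid_step ih hs

/-- A bound for the number of remaining steps. -/
noncomputable def Config.rank : Config Λ → ℕ
  | .start => 2 * P.nodes.card + 3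
  | .expansion _ G => 2 * (P.nodes.card - G.length) + 2
  | .propagation _ G => 2 * (P.nodes.card - G.length) + 3
  | .final _ => 1
  | .halt _ => 0

theorem rank_step {c c' : Config Λ} {s : ℕ} (h : Config.Valid P c) (hs : P.Step c s c') :
    Config.rank P c' < Config.rank P c := by
  cases hs with
  | start => simp [Config.rank]
  | expansion u U G hu =>
    obtain ⟨⟨U', e, h'⟩, -⟩ := P.expand_spec hu h.2
    -- The enlarged `G` still fits among the nodes, so the truncated subtraction in the rank really
    -- drops by one; its factor `2` pays for the `+ 3` of a propagation.
    have := h'.length_le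
    rw [e]
    simp only [Config.rank, List.length_cons] at *
    omega
  | propagation doE doA U G =>
    rcases P.propagate_val doE doA U G with ⟨b, e⟩ | e
    · rw [e]; simp [Config.rank]
    · rw [e]; cases U <;> simp [Config.rank, proceed]
  | final G => simp [finish, Timed.bind, Timed.pure, Config.rank]

theorem terminates : P.Terminates := by
  constructor
  · rintro ⟨c, h0, hc⟩
    have hv : ∀ i, Config.Valid P (c i) := by
      intro i
      induction i with
      | zero => rw [h0]; trivial
      | succ i ih => obtain ⟨s, hs⟩ := hc i; exact P.valid_step ih hs
    have hr : ∀ i, Config.rank P (c i) + i ≤ Config.rank P (c 0) := by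
      intro i
      induction i with
      | zero => simp
      | succ i ih =>
        obtain ⟨s, hs⟩ := hc i
        have := P.rank_step (hv i) hs
        omega
    have := hr (Config.rank P (c 0) + 1)
    omega
  · intro s c hrun hstuck
    have hv := P.valid_run hrun
    cases c with
    | start => exact absurd .start (hstuck _ _)
    | expansion U G =>
      obtain ⟨u, hu⟩ := List.exists_mem_of_ne_nil _ hv.1
      exact absurd (.expansion u U G hu) (hstuck _ _)
    | propagation U G => exact absurd (.propagation true true U G) (hstuck _ _)
    | final G => exact absurd (.final G) (hstuck _ _)
    | halt b => exact ⟨b, rfl⟩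

/-- `s` is at most the time spent so far if each expansion takes time `e` and each propagation takes
time `d`. -/
def Config.TimeBound (e d s : ℕ) : Config Λ → Prop
  | .start => s = 0
  | .expansion _ G => s ≤ P.opCost + G.length * (e + d)
  | .propagation _ G => s + d ≤ P.opCost + G.length * (e + d)
  | .final G => s ≤ P.opCost + G.length * (e + d)
  | .halt _ => s ≤ P.opCost + (P.nodes.card + 1) * (e + d)

theorem run_time_le {t : ℕ → ℕ → ℕ} (ht : P.solver.RunsIn t) {s : ℕ} {c : Config Λ}
    (h : P.Run s c) :
    s ≤ P.opCost + (P.nodes.card + 1) *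
      (P.expandCost P.nodes.card + P.propagateCost t P.nodes.card) := by
  set e := P.expandCost P.nodes.card
  set d := P.propagateCost t P.nodes.card
  suffices hb : Config.TimeBound P e d s c by
    have hv := P.valid_run h
    have hle : ∀ m, m ≤ P.nodes.card → m * (e + d) ≤ (P.nodes.card + 1) * (e + d) :=
      fun m hm => Nat.mul_le_mul_right _ (by omega)
    cases c with
    | start => simp only [Config.TimeBound] at hb; omega
    | expansion U G =>
      have := hle G.length (by have := hv.2.length_le; omega)
      simp only [Config.TimeBound] at hb; omega
    | propagation U G =>
      have := hle G.length (by have := hv.2.length_le; omega)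
      simp only [Config.TimeBound] at hb; omega
    | final G =>
      have := hle G.length (by have := IsPartition.length_le hv; omega)
      simp only [Config.TimeBound] at hb; omega
    | halt b => exact hb
  induction h with
  | nil => rfl
  | cons s s' c c' hrun hs ih =>
    have hv := P.valid_run hrun
    -- The propagation in step 4 comes on top of one round per expanded node; the extra round in the
    -- bound pays for it. The propagation after an expansion is already paid for by the `s + d` in
    -- its bound.
    have hlast : ∀ m, m ≤ P.nodes.card → m * (e + d) + (e + d) ≤ (P.nodes.card + 1) * (e + d) :=
      fun m hm => by rw [← Nat.succ_mul]; exact Nat.mul_le_mul_right _ (by omega)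
    cases hs with
    | start => simp only [Config.TimeBound] at ih ⊢; simp [ih]
    | expansion u U G hu =>
      obtain ⟨⟨U', e1, h'⟩, ht'⟩ := P.expand_spec hu hv.2
      rw [e1]
      simp only [Config.TimeBound, List.length_cons] at ih ⊢
      rw [Nat.succ_mul]
      omega
    | propagation doE doA U G =>
      have hl := hv.2.length_le
      have htime := P.propagate_time_le ht doE doA (U := U) (G := G) (by omega)
      simp only [Config.TimeBound] at ih
      rcases P.propagate_val doE doA U G with ⟨b, e1⟩ | e1
      · rw [e1]
        have := hlast G.length (by omega)
        simp only [Config.TimeBound]; omega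
      · rw [e1]
        cases U <;> simp only [proceed, Config.TimeBound] <;> omega
    | final G =>
      have hl := IsPartition.length_le hv
      have htime := P.finish_time_le ht (G := G) (by omega)
      have := hlast G.length (by omega)
      simp only [Config.TimeBound, finish, Timed.bind, Timed.pure] at ih htime ⊢
      omega

end Setting

/-! ### Comparison with powers of factorials -/

section Arithmetic

/-- One term of the exponential series, together with `e < 3`. For `m = q` this is a weak Stirling
bound; for fixed `m` it bounds monomials by an exponential. -/
theorem pow_le_factorial_mul_three_pow (m q : ℕ) : q ^ m ≤ m.factorial * 3 ^ q := by
  have h := Real.pow_div_factorial_le_exp (q : ℝ) (Nat.cast_nonneg q) m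
  rw [div_le_iff₀ (by positivity)] at h
  have h3 : Real.exp q ≤ 3 ^ q := by
    rw [← mul_one (q : ℝ), Real.exp_nat_mul]
    exact pow_le_pow_left₀ (Real.exp_nonneg _) Real.exp_one_lt_three.le _
  have : ((q ^ m : ℕ) : ℝ) ≤ ((m.factorial * 3 ^ q : ℕ) : ℝ) := by
    push_cast
    calc (q : ℝ) ^ m ≤ Real.exp q * m.factorial := h
      _ ≤ 3 ^ q * m.factorial := by gcongr
      _ = _ := mul_comm _ _
  exact_mod_cast this

theorem exists_eval_le_mul_three_pow (p : Polynomial ℕ) : ∃ B, ∀ q, p.eval q ≤ B * 3 ^ q := by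
  refine ⟨∑ i ∈ Finset.range (p.natDegree + 1), p.coeff i * i.factorial, fun q => ?_⟩
  rw [Polynomial.eval_eq_sum_range, Finset.sum_mul]
  refine Finset.sum_le_sum fun i _ => ?_
  rw [mul_assoc]
  exact Nat.mul_le_mul_left _ (pow_le_factorial_mul_three_pow i q)

/-- Powers of the number of nodes are dominated by powers of factorials. -/
theorem pow_pow_mul_le_factorial_pow {q : ℕ} (hq : 192 * 81 ≤ q) :
    ((q + 4) ^ (q + 1)) ^ (2 * q + 3) * 24 ^ q ≤ q.factorial ^ (4 * q) := by
  -- `81 ^ (q ^ 2) = (3 ^ q) ^ (4 * q)` is what is lost by raising `q ^ q ≤ q! * 3 ^ q` to the power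
  -- `4 * q`.
  have h81 : 0 < 81 ^ (q ^ 2) := by positivity
  refine Nat.le_of_mul_le_mul_right ?_ h81
  -- The true leading term is `2 * q ^ 2`. Rounding up to `3 * q ^ 2` still leaves `q ^ (q ^ 2)` to
  -- absorb the constants `2 ^ 3 * 24 * 81 = 192 * 81`, which explains the threshold for `q`.
  have he : (q + 1) * (2 * q + 3) ≤ 3 * q ^ 2 := by nlinarith
  calc ((q + 4) ^ (q + 1)) ^ (2 * q + 3) * 24 ^ q * 81 ^ (q ^ 2)
      = (q + 4) ^ ((q + 1) * (2 * q + 3)) * 24 ^ q * 81 ^ (q ^ 2) := by rw [pow_mul]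
    _ ≤ (2 * q) ^ (3 * q ^ 2) * 24 ^ (q ^ 2) * 81 ^ (q ^ 2) := by
        gcongr ?_ * ?_ * _
        · exact (Nat.pow_le_pow_left (by omega) _).trans (Nat.pow_le_pow_right (by omega) he)
        · exact Nat.pow_le_pow_right (by norm_num) (by nlinarith)
    _ = (192 * 81) ^ (q ^ 2) * q ^ (3 * q ^ 2) := by
        rw [mul_pow 2 q, pow_mul 2 3]
        rw [show (192 * 81 : ℕ) = 2 ^ 3 * 24 * 81 by norm_num, mul_pow, mul_pow]
        ring
    _ ≤ q ^ (q ^ 2) * q ^ (3 * q ^ 2) := by gcongr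
    _ = (q ^ q) ^ (4 * q) := by rw [← pow_add, ← pow_mul]; congr 1; ring
    _ ≤ (q.factorial * 3 ^ q) ^ (4 * q) := by
        gcongr
        exact pow_le_factorial_mul_three_pow q q
    _ = q.factorial ^ (4 * q) * 81 ^ (q ^ 2) := by
        rw [mul_pow, ← pow_mul 3, show (81 : ℕ) = 3 ^ 4 by norm_num, ← pow_mul 3]
        congr 2; ring

theorem exists_cost_le_factorial_pow (p : Polynomial ℕ) : ∃ C, ∀ q,
    (43 + 8 * q) * ((q + 4) ^ (q + 1)) ^ (2 * q + 3) * (p.eval q + 1) * 4 ^ q ≤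
      C * q.factorial ^ (4 * q) := by
  obtain ⟨B, hB⟩ := exists_eval_le_mul_three_pow p
  set K : ℕ → ℕ := fun q =>
    (43 + 8 * q) * ((q + 4) ^ (q + 1)) ^ (2 * q + 3) * (p.eval q + 1) * 4 ^ q with hK
  -- The first summand serves large `q`, where `51 = 43 + 8` comes from `43 + 8 * q ≤ 51 * 2 ^ q`
  -- and the factors `2 ^ q`, `3 ^ q`, `4 ^ q` combine to `24 ^ q`. The sum covers all smaller `q`.
  refine ⟨51 * (B + 1) + ∑ q ∈ Finset.range (192 * 81), K q, fun q => ?_⟩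
  have hf : 1 ≤ q.factorial ^ (4 * q) := Nat.pow_pos (Nat.factorial_pos q)
  rw [add_mul (51 * (B + 1))]
  by_cases hq : 192 * 81 ≤ q
  · refine le_trans ?_ (Nat.le_add_right _ _)
    have h1 : 43 + 8 * q ≤ 51 * 2 ^ q := by
      have := Nat.lt_two_pow_self (n := q); omega
    have h2 : p.eval q + 1 ≤ (B + 1) * 3 ^ q := by
      have := hB q; have : 1 ≤ 3 ^ q := Nat.one_le_pow _ _ (by norm_num)
      rw [add_mul]; omega
    calc _ ≤ (51 * 2 ^ q) * ((q + 4) ^ (q + 1)) ^ (2 * q + 3) * ((B + 1) * 3 ^ q) * 4 ^ q := by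
          gcongr
      _ = 51 * (B + 1) * (((q + 4) ^ (q + 1)) ^ (2 * q + 3) * 24 ^ q) := by
          rw [show (24 : ℕ) = 2 * 3 * 4 by norm_num, mul_pow, mul_pow]; ring
      _ ≤ _ := Nat.mul_le_mul_left _ (pow_pow_mul_le_factorial_pow hq)
  · refine le_trans ?_ (Nat.le_add_left _ _)
    calc K q ≤ ∑ q ∈ Finset.range (192 * 81), K q :=
          Finset.single_le_sum (f := K) (fun _ _ => Nat.zero_le _)
            (Finset.mem_range.2 (not_le.1 hq))
      _ ≤ _ := Nat.le_mul_of_pos_right _ hf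

end Arithmetic

/-! ### Collecting the costs -/

namespace Setting

variable {T : Type u → Type u} [Functor T] {Λ : Type u} {L : CoalgebraicLogic T Λ} (P : Setting L)

/-- The empty instance already takes a step. This lets costs unrelated to the one-step procedure be
multiplied by `t n (2 ^ n)`. -/
theorem one_le_of_runsIn {t : ℕ → ℕ → ℕ} (ht : P.solver.RunsIn t) : 1 ≤ t P.n (2 ^ P.n) :=
  (P.solver.steps_pos ∅ ∅).trans_le
    (ht ∅ ∅ (by simp [IsOneStepInput]) _ _ (by simp [CoalgebraicLogic.inputSize]) (by simp))

theorem n_le_mul : P.n ≤ P.n * P.k := Nat.le_mul_of_pos_right _ P.one_le_k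

theorem total_cost_le (t : ℕ → ℕ → ℕ) (ht : 1 ≤ t P.n (2 ^ P.n)) {R : ℕ} (hR : 1 ≤ R) :
    P.opCost + (R + 1) * (P.expandCost R + P.propagateCost t R) ≤
      (43 + 8 * (P.n * P.k)) * R ^ (2 * (P.n * P.k) + 3) * (P.opCost + 1) * 4 ^ (P.n * P.k) *
        t P.n (2 ^ P.n) := by
  set w := P.opCost with hw
  set τ := t P.n (2 ^ P.n) with hτ
  set q := P.n * P.k with hq
  set S := 2 ^ P.n with hS
  have hS1 : 1 ≤ S := Nat.one_le_two_pow
  have hS2 : S ^ 2 ≤ 4 ^ q := by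
    rw [hS, ← pow_mul, mul_comm, pow_mul]
    exact Nat.pow_le_pow_right (by norm_num) P.n_le_mul
  set X := (w + 1) * S ^ 2 * τ with hX
  -- Each monomial in the cost of a check or an expansion is at most linear in `w`, `τ` and `R` and
  -- quadratic in `S`, hence bounded by `X * R`. The square of `S` comes from removing duplicates
  -- from a list of up to `S` labels.
  have hmon : ∀ a b c d, a ≤ w + 1 → b ≤ S ^ 2 → c ≤ τ → d ≤ R → a * b * c * d ≤ X * R :=
    fun a b c d h1 h2 h3 h4 => by rw [hX]; gcongr
  have hSS : S ≤ S ^ 2 := Nat.le_self_pow (by norm_num) S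
  have hS0 : 1 ≤ S ^ 2 := hS1.trans hSS
  have m1 : w ≤ X * R := by simpa using hmon w 1 1 1 (by omega) hS0 ht hR
  have m2 : S * w ≤ X * R := by simpa [mul_comm] using hmon w S 1 1 (by omega) hSS ht hR
  have m3 : S * w * R ≤ X * R := by
    simpa [mul_comm, mul_assoc] using hmon w S 1 R (by omega) hSS ht le_rfl
  have m4 : S ^ 2 * w ≤ X * R := by
    simpa [mul_comm] using hmon w (S ^ 2) 1 1 (by omega) le_rfl ht hR
  have m5 : τ ≤ X * R := by simpa using hmon 1 1 τ 1 (by omega) hS0 le_rfl hR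
  have m6 : w * R ≤ X * R := by simpa using hmon w 1 1 R (by omega) hS0 ht le_rfl
  have m7 : w ≤ X := by
    calc w = w * 1 * 1 := by ring
      _ ≤ X := by rw [hX]; gcongr; omega
  have hcheck : P.checkCost t R ≤ 6 * (X * R) := by
    calc P.checkCost t R = w + 2 * (S * w) + S * w * R + S ^ 2 * w + τ := by
          simp only [checkCost, ← hw, ← hτ, ← hS]; ring
      _ ≤ _ := by omega
  have hexpand : P.expandCost R ≤ 6 * (X * R) := by
    calc P.expandCost R = w + w * R + 2 * (S * w) + 2 * (S * w * R) := by
          simp only [expandCost, ← hw, ← hS]; ring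
      _ ≤ _ := by omega
  have hfix : P.fixpointCost t R ≤ (6 + 2 * q) * (X * R ^ (2 * q + 2)) := by
    calc P.fixpointCost t R = R ^ (2 * q) * (R * P.checkCost t R + 2 * q * w) := by
          simp only [fixpointCost, ← hw, hq, mul_assoc]
      _ ≤ R ^ (2 * q) * (R * (6 * (X * R)) + 2 * q * (X * R ^ 2)) := by
          gcongr
          exact m7.trans (Nat.le_mul_of_pos_right _ (Nat.pow_pos hR))
      _ = _ := by ring
  have hXR : X * R ≤ X * R ^ (2 * q + 2) :=
    Nat.mul_le_mul_left _ (Nat.le_self_pow (by omega) R)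
  have hprop : P.propagateCost t R ≤ (15 + 4 * q) * (X * R ^ (2 * q + 2)) := by
    calc P.propagateCost t R = 2 * P.fixpointCost t R + 2 * (w * R) + w := by
          simp only [propagateCost, ← hw]; ring
      _ ≤ 2 * ((6 + 2 * q) * (X * R ^ (2 * q + 2))) + 2 * (X * R ^ (2 * q + 2)) +
          X * R ^ (2 * q + 2) := by
          gcongr ?_ + 2 * ?_ + ?_
          · exact Nat.mul_le_mul_left _ hfix
          · exact m6.trans hXR
          · exact m1.trans hXR
      _ = _ := by ring
  -- With `R + 1 ≤ R + R`, the coefficient is `1 + 2 * (6 + 15 + 4 * q) = 43 + 8 * q`.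
  calc w + (R + 1) * (P.expandCost R + P.propagateCost t R)
      ≤ X * R ^ (2 * q + 3) + (R + R) * (6 * (X * R ^ (2 * q + 2)) +
          (15 + 4 * q) * (X * R ^ (2 * q + 2))) := by
        gcongr
        · exact m7.trans (Nat.le_mul_of_pos_right _ (Nat.pow_pos hR))
        · exact hexpand.trans (Nat.mul_le_mul_left _ hXR)
    _ = (43 + 8 * q) * R ^ (2 * q + 3) * (w + 1) * S ^ 2 * τ := by rw [hX]; ring
    _ ≤ _ := by gcongr

end Setting

end CoalgMu

/-! ### The main theorem -/

theorem mainTheorem5 (p : Polynomial ℕ) :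
    ∃ C : ℕ, ∀ (T : Type u → Type u) [Functor T] [LawfulFunctor T] (Λ : Type u)
      (L : CoalgMu.CoalgebraicLogic T Λ) (P : CoalgMu.Setting L) (t : ℕ → ℕ → ℕ),
      P.solver.RunsIn t → P.opCost ≤ p.eval (P.n * P.k) →
      (∀ G : List (CoalgMu.Node Λ),
        {v | v ∈ (P.computeE G).val} = P.E {v | v ∈ G} ∧
        {v | v ∈ (P.computeA G).val} = P.A {v | v ∈ G}) ∧
      P.Terminates ∧
      ∀ (s : ℕ) (c : CoalgMu.Config Λ), P.Run s c →
        s ≤ C * (Nat.factorial (P.n * P.k) ^ (4 * P.n * P.k) * t P.n (2 ^ P.n)) := by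
  obtain ⟨C, hC⟩ := CoalgMu.exists_cost_le_factorial_pow p
  refine ⟨C, fun T _ _ Λ L P t ht hp => ⟨fun G => ⟨P.computeE_val G, P.computeA_val G⟩,
    P.terminates, fun s c hrun => ?_⟩⟩
  calc s ≤ _ := P.run_time_le ht hrun
    _ ≤ _ := P.total_cost_le t (P.one_le_of_runsIn ht) P.one_le_card_nodes
    _ ≤ (43 + 8 * (P.n * P.k)) *
          ((P.n * P.k + 4) ^ (P.n * P.k + 1)) ^ (2 * (P.n * P.k) + 3) *
          (p.eval (P.n * P.k) + 1) * 4 ^ (P.n * P.k) * t P.n (2 ^ P.n) := by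
        gcongr
        exact P.card_nodes_le
    _ ≤ C * Nat.factorial (P.n * P.k) ^ (4 * (P.n * P.k)) * t P.n (2 ^ P.n) := by
        exact Nat.mul_le_mul_right _ (hC _)
    _ = _ := by rw [mul_assoc C, mul_assoc 4]
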